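/- Let $\Bbbk$ be an algebraically closed field of characteristic $0$ and let $\mathfrak g$ be a finite-dimensional simple Lie algebra over $\Bbbk$ with a short grading $\mathfrak g=\mathfrak g(-1)\oplus\mathfrak g(0)\oplus\mathfrak g(1)$, i.e. a $\mathbb Z$-grading whose nonzero terms are exactly those of degrees $-1,0,1$. Let $G(0)$ be the subgroup of grading-preserving elements of the adjoint group of $\mathfrak g$ (the connected group with Lie algebra $\mathfrak g(0)$), and let $e\in\mathfrak g(1)$ belong to the dense $G(0)$-orbit in $\mathfrak g(1)$. Put $\mathfrak k=\mathfrak g(0)^e=\{x\in\mathfrak g(0)\mid [x,e]=0\}$ and $\mathfrak m=[e,\mathfrak g(-1)]\subset\mathfrak g(0)$, and suppose that $\mathfrak k$ is reductive. Then there are an element $h\in\mathfrak g(0)$ with $\mathfrak g(i)=\{x\in\mathfrak g\mid [h,x]=2ix\}$ for all $i$, an element $f\in\mathfrak g(-1)$ with $[e,f]=h$, and commuting involutive automorphisms $\sigma_1,\sigma_2$ of $\mathfrak g$ such that $\sigma_1$ is $1$ on $\mathfrak g(0)$ and $-1$ on $\mathfrak g(-1)\oplus\mathfrak g(1)$, while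 $\sigma_2$ is $1$ on $\mathfrak k$, $-1$ on $\mathfrak m$, and $\sigma_2(e)=f$ (these data, with $\sigma_3=\sigma_1\sigma_2$, are the Jordan triad of the grading). Moreover, $\mathfrak g(-1)$ with the product $x\circ y=[x,[e,y]]$ is a simple Jordan algebra. For any such data, let $\mathfrak g_{ij}=\{x\in\mathfrak g\mid \sigma_1(x)=(-1)^ix,\ \sigma_2(x)=(-1)^jx\}$ for $i,j\in\{0,1\}$. Then $$\mathfrak g_{01}=\mathfrak m,\qquad \mathfrak g_{10}=[\mathfrak m,e-f],\qquad \mathfrak g_{11}=[\mathfrak m,e+f],$$ and the commuting variety $\{(x,y)\in\mathfrak g(-1)\times\mathfrak g(-1)\mid x\circ y=0\}$ of the Jordan algebra $(\mathfrak g(-1),\circ)$ is isomorphic, as an affine variety, to the zero fibre $\varphi^{-1}(0)$ of the commutator mapping $$\varphi:\mathfrak g_{10}\times\mathfrak g_{11}=[\mathfrak m,e-f]\times[\mathfrak m,e+f]\longrightarrow\mathfrak m=\mathfrak g_{01},\qquad \varphi(u,v)=[u,v].$$ -/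

import Mathlib

namespace JordanCommuting

section AffineGeometry

variable (K : Type*) [Field K] {V W : Type*} [AddCommGroup V] [Module K V]
  [AddCommGroup W] [Module K W]

/-- The algebra of polynomial functions on a vector space: the `K`-algebra of functions
generated by the linear forms. -/
def polynomialFunctions (V : Type*) [AddCommGroup V] [Module K V] : Subalgebra K (V → K) :=
  Algebra.adjoin K (Set.range fun φ : Module.Dual K V => (φ : V → K))

/-- `S` is Zariski dense in the vector space `V`: a polynomial function vanishing on `S`
vanishes everywhere. -/
def IsZariskiDense (S : Set V) : Prop :=
  ∀ p ∈ polynomialFunctions K V, (∀ v ∈ S, p v = 0) → ∀ v, p v = 0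

/-- A map between subsets of vector spaces is regular if it pulls back (restrictions of)
polynomial functions to (restrictions of) polynomial functions. -/
def IsRegularMap {X : Set V} {Y : Set W} (F : X → Y) : Prop :=
  ∀ q ∈ polynomialFunctions K W, ∃ p ∈ polynomialFunctions K V,
    ∀ x : X, p (x : V) = q (F x : W)

/-- Isomorphism of (reduced) affine varieties given as subsets of vector spaces:
a bijection that is regular in both directions. -/
def AreIsomorphicVarieties (X : Set V) (Y : Set W) : Prop :=
  ∃ F : X ≃ Y, IsRegularMap K (F : X → Y) ∧ IsRegularMap K (F.symm : Y → X)

end AffineGeometry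

/-- The commuting variety of a (nonassociative) algebra: the zero fibre of its
multiplication map. -/
def commutingVariety (A : Type*) [Mul A] [Zero A] : Set (A × A) :=
  {p | p.1 * p.2 = 0}

section Lie

variable (K : Type*) {g : Type*} [Field K] [LieRing g] [LieAlgebra K g]

/-- The adjoint group of `g`: the group generated by all
`exp (ad x) = ∑ (ad x)^i / i!` with `ad x` nilpotent. For `g` semisimple over an algebraically
closed field of characteristic zero, it is the identity component of the automorphism group of
`g`, that is, the image in `GL(g)` of any connected algebraic group with Lie algebra `g`. -/
def adjointGroup (g : Type*) [LieRing g] [LieAlgebra K g] : Subgroup (g ≃ₗ[K] g) :=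
  Subgroup.closure {φ | ∃ (x : g) (n : ℕ), (LieAlgebra.ad K g x) ^ n = 0 ∧
    (φ : Module.End K g) =
      ∑ i ∈ Finset.range n, ((i.factorial : K)⁻¹) • (LieAlgebra.ad K g x) ^ i}

variable {K}
variable (𝒢 : ℤ → Submodule K g)

/-- The grading has exactly three nonzero terms, those of degree `-1`, `0` and `1`. -/
def IsShortGrading : Prop :=
  ∀ i : ℤ, 𝒢 i ≠ ⊥ ↔ i = -1 ∨ i = 0 ∨ i = 1

/-- The group `G(0)` with Lie algebra `g(0)`, acting on `g`: the elements of the adjoint group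
that preserve the grading. Equivalently, this is the centraliser in the adjoint group of the
element defining the grading; such a centraliser is connected. -/
def groupZero : Subgroup (g ≃ₗ[K] g) where
  carrier := {φ | φ ∈ adjointGroup K g ∧ ∀ i x, φ x ∈ 𝒢 i ↔ x ∈ 𝒢 i}
  mul_mem' := by
    rintro φ ψ ⟨hφ, hφ'⟩ ⟨hψ, hψ'⟩
    exact ⟨mul_mem hφ hψ, fun i x => (hφ' i (ψ x)).trans (hψ' i x)⟩
  one_mem' := ⟨one_mem _, fun _ _ => Iff.rfl⟩
  inv_mem' := by
    rintro φ ⟨hφ, hφ'⟩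
    refine ⟨inv_mem hφ, fun i x => ?_⟩
    have h := hφ' i (φ⁻¹ x)
    rw [← LinearEquiv.mul_apply, mul_inv_cancel] at h
    exact h.symm

/-- `e` lies in the dense `G(0)`-orbit of `g(1)`: its orbit is Zariski dense in `g(1)`. -/
def InDenseOrbit (e : 𝒢 1) : Prop :=
  IsZariskiDense K {v : 𝒢 1 | ∃ φ ∈ groupZero 𝒢, φ (e : g) = (v : g)}

/-- The subalgebra `𝔨 = g(0)^e`, the centraliser of `e` in `g(0)`. -/
def zeroCentralizer [GradedLieAlgebra 𝒢] (e : 𝒢 1) : LieSubalgebra K g where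
  carrier := {x | x ∈ 𝒢 0 ∧ ⁅x, (e : g)⁆ = 0}
  add_mem' := by
    rintro x y ⟨hx, hx'⟩ ⟨hy, hy'⟩
    exact ⟨add_mem hx hy, by rw [add_lie, hx', hy', add_zero]⟩
  zero_mem' := ⟨zero_mem _, zero_lie _⟩
  smul_mem' := by
    rintro c x ⟨hx, hx'⟩
    exact ⟨Submodule.smul_mem _ c hx, by rw [smul_lie, hx', smul_zero]⟩
  lie_mem' := by
    rintro x y ⟨hx, hx'⟩ ⟨hy, hy'⟩
    refine ⟨?_, by rw [lie_lie, hx', hy', lie_zero, lie_zero, sub_zero]⟩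
    simpa using SetLike.GradedBracket.bracket_mem (ℒ := 𝒢) hx hy

/-- The subspace `𝔪 = [e, g(-1)]` of `g(0)`. -/
def mSubspace (e : 𝒢 1) : Submodule K g :=
  (𝒢 (-1)).map (LieAlgebra.ad K g (e : g) : g →ₗ[K] g)

/-- The underlying space of the algebra `(g(-1), ∘)` with `x ∘ y = [x, [e, y]]`. -/
def JordanPart (𝒢 : ℤ → Submodule K g) (_e : 𝒢 1) : Type _ := 𝒢 (-1)

namespace JordanPart

variable {𝒢}
variable (e : 𝒢 1)

instance : AddCommGroup (JordanPart 𝒢 e) := inferInstanceAs (AddCommGroup (𝒢 (-1)))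

instance : Module K (JordanPart 𝒢 e) := inferInstanceAs (Module K (𝒢 (-1)))

/-- The inclusion of `g(-1)` in `g`. -/
def val {e : 𝒢 1} : JordanPart 𝒢 e →ₗ[K] g := (𝒢 (-1)).subtype

variable {e}

theorem val_mem (x : JordanPart 𝒢 e) : val x ∈ 𝒢 (-1) := x.2

theorem val_injective : Function.Injective (val : JordanPart 𝒢 e → g) :=
  Subtype.val_injective

variable [GradedLieAlgebra 𝒢]

theorem mul_mem_aux (x y : JordanPart 𝒢 e) : ⁅val x, ⁅(e : g), val y⁆⁆ ∈ 𝒢 (-1) := by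
  have h1 := SetLike.GradedBracket.bracket_mem (ℒ := 𝒢) e.2 (val_mem y)
  simpa using SetLike.GradedBracket.bracket_mem (ℒ := 𝒢) (val_mem x) h1

/-- The product `x ∘ y = [x, [e, y]]`. -/
instance : Mul (JordanPart 𝒢 e) :=
  ⟨fun x y => ⟨⁅val x, ⁅(e : g), val y⁆⁆, mul_mem_aux x y⟩⟩

theorem val_mul (x y : JordanPart 𝒢 e) : val (x * y) = ⁅val x, ⁅(e : g), val y⁆⁆ := rfl

instance : NonUnitalNonAssocRing (JordanPart 𝒢 e) where
  left_distrib x y z := val_injective (by simp only [val_mul, map_add, lie_add])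
  right_distrib x y z := val_injective (by simp only [val_mul, map_add, add_lie])
  zero_mul x := val_injective (by simp only [val_mul, map_zero, zero_lie])
  mul_zero x := val_injective (by simp only [val_mul, map_zero, lie_zero])

end JordanPart

/-- A (nonassociative) ring is a simple Jordan algebra: commutative, with the Jordan identity,
and simple. (A simple ring has no proper nonzero ideals at all; in particular it has none that
are subspaces.) -/
def IsSimpleJordan (A : Type*) [NonUnitalNonAssocRing A] : Prop :=
  (∀ x y : A, x * y = y * x) ∧ (∀ x y : A, (x * y) * (x * x) = x * (y * (x * x))) ∧
    IsSimpleRing A ∧ ∃ x y : A, x * y ≠ 0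

/-- The summand `g_{ij}` of the quaternionic decomposition determined by `σ₁` and `σ₂`. -/
def quaternionicPart (σ₁ σ₂ : g ≃ₗ⁅K⁆ g) (i j : ℕ) : Submodule K g where
  carrier := {x | σ₁ x = (-1 : K) ^ i • x ∧ σ₂ x = (-1 : K) ^ j • x}
  add_mem' := by
    rintro x y ⟨hx, hx'⟩ ⟨hy, hy'⟩
    exact ⟨by rw [map_add, hx, hy, smul_add], by rw [map_add, hx', hy', smul_add]⟩
  zero_mem' := ⟨by rw [map_zero, smul_zero], by rw [map_zero, smul_zero]⟩
  smul_mem' := by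
    rintro c x ⟨hx, hx'⟩
    exact ⟨by rw [map_smul, hx, smul_comm], by rw [map_smul, hx', smul_comm]⟩

theorem lie_mem_quaternionicPart (σ₁ σ₂ : g ≃ₗ⁅K⁆ g) {x y : g}
    (hx : x ∈ quaternionicPart σ₁ σ₂ 1 0) (hy : y ∈ quaternionicPart σ₁ σ₂ 1 1) :
    ⁅x, y⁆ ∈ quaternionicPart σ₁ σ₂ 0 1 := by
  obtain ⟨hx, hx'⟩ := hx
  obtain ⟨hy, hy'⟩ := hy
  constructor
  · rw [LieEquiv.map_lie, hx, hy]; simp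
  · rw [LieEquiv.map_lie, hx', hy']; simp

/-- The commutator mapping `φ : g₁₀ × g₁₁ → g₀₁`. -/
def commutatorMap (σ₁ σ₂ : g ≃ₗ⁅K⁆ g)
    (p : quaternionicPart σ₁ σ₂ 1 0 × quaternionicPart σ₁ σ₂ 1 1) :
    quaternionicPart σ₁ σ₂ 0 1 :=
  ⟨⁅(p.1 : g), (p.2 : g)⁆, lie_mem_quaternionicPart σ₁ σ₂ p.1.2 p.2.2⟩

/-- The Jordan triad attached to a short grading and an element `e` of `g(1)`: the element `h`
defining the grading, the element `f ∈ g(-1)` completing `e` and `h` to an `𝔰𝔩₂`-triple, and the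
commuting involutions `σ₁`, `σ₂` (and their product `σ₃`), where `σ₁` is `1` on `g(0)` and `-1` on
`g(-1) ⊕ g(1)`, while `σ₂` is `1` on `g(0)^e`, `-1` on `𝔪`, and takes `e` to `f`. -/
structure JordanTriad (𝒢 : ℤ → Submodule K g) (e : 𝒢 1) where
  h : g
  h_mem : h ∈ 𝒢 0
  mem_iff : ∀ (i : ℤ) (x : g), x ∈ 𝒢 i ↔ ⁅h, x⁆ = (2 * (i : K)) • x
  f : g
  f_mem : f ∈ 𝒢 (-1)
  lie_e_f : ⁅(e : g), f⁆ = h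
  σ₁ : g ≃ₗ⁅K⁆ g
  σ₂ : g ≃ₗ⁅K⁆ g
  σ₃ : g ≃ₗ⁅K⁆ g
  σ₁_zero : ∀ x ∈ 𝒢 0, σ₁ x = x
  σ₁_one : ∀ x ∈ 𝒢 1, σ₁ x = -x
  σ₁_neg_one : ∀ x ∈ 𝒢 (-1), σ₁ x = -x
  σ₂_invol : ∀ x, σ₂ (σ₂ x) = x
  σ₂_centralizer : ∀ x ∈ 𝒢 0, ⁅x, (e : g)⁆ = 0 → σ₂ x = x
  σ₂_mSubspace : ∀ x ∈ mSubspace 𝒢 e, σ₂ x = -x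
  σ₂_e : σ₂ (e : g) = f
  σ_comm : ∀ x, σ₁ (σ₂ x) = σ₂ (σ₁ x)
  σ₃_eq : ∀ x, σ₃ x = σ₁ (σ₂ x)

end Lie

end JordanCommuting

/-!
Let `κ` be the Killing form, nondegenerate by Cartan's criterion, and let `h₀` be the element with
`[h₀, x] = i x` on `g(i)`, which exists because all derivations of `g` are inner.

*The tangent space of the dense orbit.* The rank of `ad v : g(0) → g(1)` is constant on the orbit
of `e`, which is Zariski dense, so it is maximal at `v = e`. Differentiating minors gives
`[g(0)^e, g(1)] ⊆ [g(0), e]` (`InDenseOrbit.lie_mem`). If `y` in `g(-1)` commutes with `e`, then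
all `[y, u]` with `u` in `g(1)` centralise `e`, and invariance of `κ` yields `[y, [y, g(1)]] = 0`.
In a short grading this forces `y = 0`: if `[y, [y, u]] = 0`, then `[y, u]` is nilpotent by
Jacobson's lemma and `κ(y, u) = 0` (`killingForm_eq_zero_of_lie_lie`). So `ad e` is injective on
`g(-1)`.

*The triple.* The same trace argument gives `f` in `g(-1)` with `[[e, f], e] = 2e`. The
intersection `𝔨 ∩ 𝔪` is an abelian ideal of `𝔨`, and `[e, f] - 2h₀`, which lies in `𝔨`, acts on it
as the identity. Since the radical of `𝔨` is central, `𝔨 ∩ 𝔪 = 0`, so that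
`(ad e)² : g(-1) → g(1)` is bijective. Then `[e, f]` acts as `2` on `g(1)`, hence `[e, f] = 2h₀`
(`exists_isGradedTriple`).

*The involutions.* With the triple `(e, h, f)`, the algebra `g` is the sum of `𝔨` and of
three-dimensional modules spanned by `y, [e, y], [e, [e, y]]` with `y` in `g(-1)`. The
automorphism `σ₁` is `(-1)^i` on `g(i)`, and `σ₂` is `σ₁` followed by
`exp (ad e) exp (-ad f) exp (ad e)`, whose effect on these pieces is a direct computation.

*The Jordan algebra.* The multiplication operators on `g(-1)` are, up to sign, the actions of
elements of `𝔪`, and the Jordan identity says that `[e, x]` and `[e, x ∘ x]` commute. An ideal is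
stable under `𝔪`, hence under `g(0) = 𝔪 + [𝔪, 𝔪]`, and `g(-1)` is an irreducible `g(0)`-module
because `g` is simple.

*The commuting varieties.* The maps `y ↦ [[e, y], e ∓ f]` are linear isomorphisms from `g(-1)` onto
`𝔤₁₀` and `𝔤₁₁`, and they satisfy `[[[e, x], e - f], [[e, y], e + f]] = -4 [e, x ∘ y]`. As `ad e`
is injective on `g(-1)`, the two commuting varieties correspond under a linear isomorphism.
-/

namespace JordanCommuting

/-! ### Commuting commutators are nilpotent -/

/-- Jacobson's lemma: in characteristic zero, a commutator `[a, b]` that commutes with `a` is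
nilpotent. -/
theorem isNilpotent_lie_of_commute {K V : Type*} [Field K] [CharZero K] [AddCommGroup V]
    [Module K V] [FiniteDimensional K V] (a b : Module.End K V) (h : Commute a (a * b - b * a)) :
    IsNilpotent (a * b - b * a) := by
  set c := a * b - b * a with hc
  have hm : minpoly K c ≠ 0 := minpoly.ne_zero (Algebra.IsIntegral.isIntegral c)
  obtain ⟨q, hq, hXq⟩ := Polynomial.exists_eq_pow_rootMultiplicity_mul_and_not_dvd _ hm 0
  rw [Polynomial.C_0, sub_zero] at hq hXq
  set k := (minpoly K c).rootMultiplicity 0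
  have hcop : IsCoprime ((Polynomial.X : Polynomial K) ^ (k + 1)) q :=
    IsCoprime.pow_left (Polynomial.irreducible_X.coprime_iff_not_dvd.2 hXq)
  obtain ⟨u, v, huv⟩ := hcop
  have hq0 : c ^ k * Polynomial.aeval c q = 0 := by
    have := minpoly.aeval K c
    rw [hq] at this
    simpa using this
  have huv' : Polynomial.aeval c u * c ^ (k + 1) + Polynomial.aeval c v * Polynomial.aeval c q
      = 1 := by
    simpa using congrArg (Polynomial.aeval c) huv
  -- The idempotent projecting onto the part of `V` where `c` is invertible.
  set π := Polynomial.aeval c u * c ^ (k + 1) with hπ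
  have hcq : c ^ (k + 1) * Polynomial.aeval c q = 0 := by
    rw [pow_succ', mul_assoc, hq0, mul_zero]
  have comm (p r : Polynomial K) : Commute (Polynomial.aeval c p) (Polynomial.aeval c r) := by
    change _ * _ = _ * _
    rw [← map_mul, ← map_mul, mul_comm]
  have hidem : IsIdempotentElem π := by
    have h1 : π * (Polynomial.aeval c v * Polynomial.aeval c q) = 0 := by
      rw [(comm v q).eq, hπ, mul_assoc, ← mul_assoc (c ^ (k + 1)), hcq]
      simp
    have h2 := congrArg (fun t => π * t) huv'
    simp only [mul_add, h1, add_zero, mul_one] at h2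
    exact h2
  -- It has trace zero, because `tr (p [a, b]) = 0` whenever `p` commutes with `a`.
  have htr : LinearMap.trace K V π = 0 := by
    set p := Polynomial.aeval c u * c ^ k with hp
    have hpa : p * a = a * p := by
      have h1 : Commute a (Polynomial.aeval c u) := by
        have hu : Polynomial.aeval c u ∈ Algebra.adjoin K {c} :=
          Polynomial.aeval_mem_adjoin_singleton K c
        exact Algebra.commute_of_mem_adjoin_singleton_of_commute hu h
      exact ((h1.mul_right (h.pow_right k)).eq).symm
    have hπp : π = p * (a * b) - p * (b * a) := by
      rw [hπ, hp, pow_succ, ← mul_assoc, ← mul_sub]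
    rw [hπp, map_sub, ← mul_assoc, hpa, mul_assoc, LinearMap.trace_mul_comm, mul_assoc, sub_self]
  have h0 : π = 0 := LinearMap.IsIdempotentElem.eq_zero_of_trace_eq_zero hidem htr
  rw [h0, zero_add] at huv'
  refine ⟨k, ?_⟩
  rw [← mul_one (c ^ k), ← huv', (comm v q).eq, ← mul_assoc, hq0, zero_mul]

/-! ### Short gradings -/

section Grading

variable {K : Type*} {g : Type*} [Field K] [LieRing g] [LieAlgebra K g]
variable {𝒢 : ℤ → Submodule K g}

theorem IsShortGrading.eq_zero_of_mem (hs : IsShortGrading 𝒢) {i : ℤ} {x : g} (hx : x ∈ 𝒢 i)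
    (hi : 1 < |i|) : x = 0 := by
  have : 𝒢 i = ⊥ := by
    by_contra h
    rcases (hs i).1 h with rfl | rfl | rfl <;> simp at hi
  simpa [this] using hx

variable [GradedLieAlgebra 𝒢]

theorem lie_mem_grading {i j k : ℤ} {x y : g} (hx : x ∈ 𝒢 i) (hy : y ∈ 𝒢 j) (h : i + j = k) :
    ⁅x, y⁆ ∈ 𝒢 k := by
  subst h
  exact SetLike.GradedBracket.bracket_mem hx hy

theorem IsShortGrading.lie_one_one (hs : IsShortGrading 𝒢) {x y : g} (hx : x ∈ 𝒢 1)
    (hy : y ∈ 𝒢 1) : ⁅x, y⁆ = 0 :=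
  hs.eq_zero_of_mem (lie_mem_grading hx hy rfl) (by decide)

theorem IsShortGrading.lie_neg_neg (hs : IsShortGrading 𝒢) {x y : g} (hx : x ∈ 𝒢 (-1))
    (hy : y ∈ 𝒢 (-1)) : ⁅x, y⁆ = 0 :=
  hs.eq_zero_of_mem (lie_mem_grading hx hy rfl) (by decide)

theorem IsShortGrading.exists_eq_add (hs : IsShortGrading 𝒢) (x : g) :
    ∃ a ∈ 𝒢 (-1), ∃ b ∈ 𝒢 0, ∃ c ∈ 𝒢 1, x = a + b + c := by
  induction x using DirectSum.Decomposition.inductionOn 𝒢 with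
  | zero => exact ⟨0, zero_mem _, 0, zero_mem _, 0, zero_mem _, by simp⟩
  | @homogeneous i m =>
    by_cases hi : 𝒢 i = ⊥
    · have : (m : g) = 0 := by simpa [hi] using m.2
      exact ⟨0, zero_mem _, 0, zero_mem _, 0, zero_mem _, by simp [this]⟩
    · rcases (hs i).1 hi with rfl | rfl | rfl
      · exact ⟨m, m.2, 0, zero_mem _, 0, zero_mem _, by simp⟩
      · exact ⟨0, zero_mem _, m, m.2, 0, zero_mem _, by simp⟩
      · exact ⟨0, zero_mem _, 0, zero_mem _, m, m.2, by simp⟩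
  | add x y hx hy =>
    obtain ⟨a, ha, b, hb, c, hc, rfl⟩ := hx
    obtain ⟨a', ha', b', hb', c', hc', rfl⟩ := hy
    exact ⟨_, add_mem ha ha', _, add_mem hb hb', _, add_mem hc hc', by abel⟩

variable (𝒢) in
/-- The projection of `g` onto its component of degree `i`. -/
noncomputable def gradingProj (i : ℤ) : g →ₗ[K] g :=
  (𝒢 i).subtype ∘ₗ DirectSum.component K ℤ (fun i => 𝒢 i) i ∘ₗ
    (DirectSum.decomposeLinearEquiv 𝒢).toLinearMap

theorem gradingProj_mem (i : ℤ) (x : g) : gradingProj 𝒢 i x ∈ 𝒢 i := by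
  simp [gradingProj]

theorem gradingProj_same {i : ℤ} {x : g} (hx : x ∈ 𝒢 i) : gradingProj 𝒢 i x = x :=
  DirectSum.decompose_of_mem_same 𝒢 hx

theorem gradingProj_ne {i j : ℤ} {x : g} (hx : x ∈ 𝒢 i) (hij : i ≠ j) :
    gradingProj 𝒢 j x = 0 :=
  DirectSum.decompose_of_mem_ne 𝒢 hx hij

theorem IsShortGrading.eq_gradingProj (hs : IsShortGrading 𝒢) (x : g) :
    x = gradingProj 𝒢 (-1) x + gradingProj 𝒢 0 x + gradingProj 𝒢 1 x := by
  obtain ⟨a, ha, b, hb, c, hc, rfl⟩ := hs.exists_eq_add x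
  simp only [map_add, gradingProj_same ha, gradingProj_same hb, gradingProj_same hc,
    gradingProj_ne ha (show (-1 : ℤ) ≠ 0 by decide),
    gradingProj_ne ha (show (-1 : ℤ) ≠ 1 by decide),
    gradingProj_ne hb (show (0 : ℤ) ≠ -1 by decide), gradingProj_ne hb (show (0 : ℤ) ≠ 1 by decide),
    gradingProj_ne hc (show (1 : ℤ) ≠ 0 by decide), gradingProj_ne hc (show (1 : ℤ) ≠ -1 by decide)]
  abel

/-- An element of degree zero of a simple Lie algebra is determined by its action on the
components of degrees `±1`: those acting trivially there form an ideal. -/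
theorem IsShortGrading.eq_zero_of_lie_eq_zero [LieAlgebra.IsSimple K g] (hs : IsShortGrading 𝒢)
    {z : g} (hz : z ∈ 𝒢 0) (h1 : ∀ x ∈ 𝒢 1, ⁅z, x⁆ = 0) (h2 : ∀ x ∈ 𝒢 (-1), ⁅z, x⁆ = 0) :
    z = 0 := by
  let I : LieIdeal K g :=
    { carrier := {z | z ∈ 𝒢 0 ∧ (∀ x ∈ 𝒢 1, ⁅z, x⁆ = 0) ∧ ∀ x ∈ 𝒢 (-1), ⁅z, x⁆ = 0}
      add_mem' := by
        rintro x y ⟨h, h1, h2⟩ ⟨h', h1', h2'⟩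
        exact ⟨add_mem h h', fun a ha => by rw [add_lie, h1 a ha, h1' a ha, add_zero],
          fun a ha => by rw [add_lie, h2 a ha, h2' a ha, add_zero]⟩
      zero_mem' := ⟨zero_mem _, fun _ _ => zero_lie _, fun _ _ => zero_lie _⟩
      smul_mem' := by
        rintro c x ⟨h, h1, h2⟩
        exact ⟨Submodule.smul_mem _ c h, fun a ha => by rw [smul_lie, h1 a ha, smul_zero],
          fun a ha => by rw [smul_lie, h2 a ha, smul_zero]⟩
      lie_mem := by
        rintro x z ⟨h, h1, h2⟩
        obtain ⟨a, ha, b, hb, c, hc, rfl⟩ := hs.exists_eq_add x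
        have hx : ⁅a + b + c, z⁆ = ⁅b, z⁆ := by
          rw [add_lie, add_lie, ← lie_skew, h2 a ha, ← lie_skew c, h1 c hc]; simp
        refine ⟨?_, fun y hy => ?_, fun y hy => ?_⟩ <;> rw [hx]
        · exact lie_mem_grading hb h rfl
        · rw [lie_lie, h1 y hy, h1 _ (lie_mem_grading hb hy rfl)]; simp
        · rw [lie_lie, h2 y hy, h2 _ (lie_mem_grading hb hy rfl)]; simp }
  rcases LieAlgebra.IsSimple.eq_bot_or_eq_top (R := K) I with h | h
  · have : z ∈ I := ⟨hz, h1, h2⟩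
    simpa [h] using this
  · exfalso
    refine (hs 1).2 (by simp) ((Submodule.eq_bot_iff _).2 fun x hx => ?_)
    have hx' : x ∈ I := by rw [h]; trivial
    rw [← gradingProj_same hx, gradingProj_ne hx'.1 (by decide)]

/-- `g(0)` is spanned by the brackets of `g(1)` with `g(-1)`: together with `g(1)` and `g(-1)`,
these brackets span an ideal. -/
theorem IsShortGrading.zero_le_span [LieAlgebra.IsSimple K g] (hs : IsShortGrading 𝒢) :
    𝒢 0 ≤ Submodule.span K {z | ∃ a ∈ 𝒢 1, ∃ b ∈ 𝒢 (-1), z = ⁅a, b⁆} := by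
  set S := Submodule.span K {z | ∃ a ∈ 𝒢 1, ∃ b ∈ 𝒢 (-1), z = ⁅a, b⁆}
  have hgen : ∀ a ∈ 𝒢 1, ∀ b ∈ 𝒢 (-1), ⁅a, b⁆ ∈ S := fun a ha b hb =>
    Submodule.subset_span ⟨a, ha, b, hb, rfl⟩
  have hgen' : ∀ a ∈ 𝒢 1, ∀ b ∈ 𝒢 (-1), ⁅b, a⁆ ∈ S := fun a ha b hb => by
    rw [← lie_skew]; exact neg_mem (hgen a ha b hb)
  have hstab : ∀ x ∈ 𝒢 0, ∀ s ∈ S, ⁅x, s⁆ ∈ S := by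
    intro x hx s hs
    induction hs using Submodule.span_induction with
    | mem s hs =>
      obtain ⟨a, ha, b, hb, rfl⟩ := hs
      rw [leibniz_lie]
      exact add_mem (hgen _ (lie_mem_grading hx ha rfl) _ hb)
        (hgen _ ha _ (lie_mem_grading hx hb rfl))
    | zero => simp
    | add s t _ _ hs ht => rw [lie_add]; exact add_mem hs ht
    | smul c s _ hs => rw [lie_smul]; exact Submodule.smul_mem _ c hs
  let I : LieIdeal K g :=
    { carrier := {x | gradingProj 𝒢 0 x ∈ S}
      add_mem' := fun hx hy => by
        simp only [Set.mem_ofPred_eq, map_add] at *; exact add_mem hx hy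
      zero_mem' := by simp
      smul_mem' := fun c x hx => by
        simp only [Set.mem_ofPred_eq, map_smul] at *; exact Submodule.smul_mem _ c hx
      lie_mem := by
        intro x y hy
        change gradingProj 𝒢 0 y ∈ S at hy
        change gradingProj 𝒢 0 ⁅x, y⁆ ∈ S
        obtain ⟨a, ha, b, hb, c, hc, rfl⟩ := hs.exists_eq_add x
        have hy1 := gradingProj_mem (𝒢 := 𝒢) (-1) y
        have hy2 := gradingProj_mem (𝒢 := 𝒢) 0 y
        have hy3 := gradingProj_mem (𝒢 := 𝒢) 1 y
        rw [hs.eq_gradingProj y]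
        simp only [add_lie, lie_add, map_add]
        rw [gradingProj_ne (lie_mem_grading ha hy1 rfl) (by decide),
          gradingProj_ne (lie_mem_grading ha hy2 rfl) (by decide),
          gradingProj_same (lie_mem_grading (k := 0) ha hy3 rfl),
          gradingProj_ne (lie_mem_grading hb hy1 rfl) (by decide),
          gradingProj_same (lie_mem_grading (k := 0) hb hy2 rfl),
          gradingProj_ne (lie_mem_grading hb hy3 rfl) (by decide),
          gradingProj_same (lie_mem_grading (k := 0) hc hy1 rfl),
          gradingProj_ne (lie_mem_grading hc hy2 rfl) (by decide),
          gradingProj_ne (lie_mem_grading hc hy3 rfl) (by decide)]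
        simp only [zero_add, add_zero]
        exact add_mem (add_mem (hgen _ hc _ hy1) (hstab _ hb _ hy)) (hgen' _ hy3 _ ha) }
  rcases LieAlgebra.IsSimple.eq_bot_or_eq_top (R := K) I with h | h
  · exfalso
    refine (hs 1).2 (by simp) ((Submodule.eq_bot_iff _).2 fun x hx => ?_)
    have hx' : x ∈ I := by
      change gradingProj 𝒢 0 x ∈ S
      rw [gradingProj_ne hx (by decide)]; exact zero_mem _
    simpa [h] using hx'
  · intro x hx
    have hx' : x ∈ I := by rw [h]; trivial
    change gradingProj 𝒢 0 x ∈ S at hx'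
    rwa [gradingProj_same hx] at hx'

end Grading

/-! ### The grading element and the Killing form -/

section Killing

variable {K : Type*} {g : Type*} [Field K] [LieRing g] [LieAlgebra K g]
variable {𝒢 : ℤ → Submodule K g}

theorem killingForm_eq_zero_of_ne [CharZero K] {h₀ : g} (hh : ∀ i, ∀ x ∈ 𝒢 i, ⁅h₀, x⁆ = (i : K) • x)
    {i j : ℤ} {x y : g} (hx : x ∈ 𝒢 i) (hy : y ∈ 𝒢 j) (hij : i + j ≠ 0) :
    killingForm K g x y = 0 := by
  have h1 : killingForm K g ⁅x, h₀⁆ y = killingForm K g x ⁅h₀, y⁆ :=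
    LieModule.traceForm_apply_lie_apply K g g x h₀ y
  rw [← lie_skew, hh i x hx, hh j y hy, map_neg, map_smul, map_smul, LinearMap.neg_apply,
    LinearMap.smul_apply, smul_eq_mul, smul_eq_mul] at h1
  have h2 : ((i + j : ℤ) : K) * killingForm K g x y = 0 := by
    push_cast
    linear_combination -h1
  exact (mul_eq_zero.1 h2).resolve_left (by exact_mod_cast hij)

variable [GradedLieAlgebra 𝒢]

theorem IsShortGrading.mem_iff_of_lie (hs : IsShortGrading 𝒢) [CharZero K] {h : g} {r : K}
    (hr : r ≠ 0) (hh : ∀ i, ∀ x ∈ 𝒢 i, ⁅h, x⁆ = (r * (i : K)) • x) (i : ℤ) (x : g) :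
    x ∈ 𝒢 i ↔ ⁅h, x⁆ = (r * (i : K)) • x := by
  refine ⟨hh i x, fun hx => ?_⟩
  have key (j : ℤ) : gradingProj 𝒢 j ⁅h, x⁆ = (r * (j : K)) • gradingProj 𝒢 j x := by
    obtain ⟨a, ha, b, hb, c, hc, rfl⟩ := hs.exists_eq_add x
    have comp {k : ℤ} {y : g} (hy : y ∈ 𝒢 k) :
        gradingProj 𝒢 j ⁅h, y⁆ = (r * (j : K)) • gradingProj 𝒢 j y := by
      rw [hh k y hy, map_smul]
      by_cases hkj : k = j
      · rw [hkj]
      · rw [gradingProj_ne hy hkj, smul_zero, smul_zero]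
    simp only [lie_add, map_add, comp ha, comp hb, comp hc, smul_add]
  have hzero (j : ℤ) (hj : j ≠ i) : gradingProj 𝒢 j x = 0 := by
    have h1 := key j
    rw [hx, map_smul] at h1
    have h2 : (r * ((i : K) - j)) • gradingProj 𝒢 j x = 0 := by
      linear_combination (norm := module) h1
    refine (smul_eq_zero.1 h2).resolve_left (mul_ne_zero hr (sub_ne_zero.2 ?_))
    exact_mod_cast hj.symm
  rw [hs.eq_gradingProj x]
  have hmem (j : ℤ) : gradingProj 𝒢 j x ∈ 𝒢 i := by
    by_cases hj : j = i
    · rw [hj]; exact gradingProj_mem i x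
    · rw [hzero j hj]; exact zero_mem _
  exact add_mem (add_mem (hmem _) (hmem _)) (hmem _)

/-- The derivation multiplying each component by its degree is inner. -/
theorem IsShortGrading.exists_gradingElement (hs : IsShortGrading 𝒢) [CharZero K]
    [FiniteDimensional K g] [LieAlgebra.IsSimple K g] :
    ∃ h₀ ∈ 𝒢 0, ∀ i, ∀ x ∈ 𝒢 i, ⁅h₀, x⁆ = (i : K) • x := by
  obtain ⟨h₀, hh₀⟩ := LieDerivation.IsKilling.exists_eq_ad
    (LieDerivation.ofGrading 𝒢 (Int.castAddHom K))
  have hh (i : ℤ) (x : g) (hx : x ∈ 𝒢 i) : ⁅h₀, x⁆ = (i : K) • x := by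
    have := LieDerivation.ofGrading_apply_apply 𝒢 (Int.castAddHom K) hx
    rw [← hh₀] at this
    simpa using this
  refine ⟨h₀, ?_, hh⟩
  rw [hs.mem_iff_of_lie one_ne_zero (by simpa using hh)]
  simp

/-- If `[x, [x, y]] = 0`, then `[x, y]` is ad-nilpotent by Jacobson's lemma; hence its product with
a commuting `ad h` has trace zero, and invariance of the Killing form gives `κ(x, y) = 0`. -/
theorem killingForm_eq_zero_of_lie_lie [CharZero K] [FiniteDimensional K g] {h x y : g} {r : K}
    (hr : r ≠ 0) (hx : ⁅h, x⁆ = r • x) (hz : ⁅h, ⁅x, y⁆⁆ = 0) (hxy : ⁅x, ⁅x, y⁆⁆ = 0) :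
    killingForm K g x y = 0 := by
  have hbr : LieAlgebra.ad K g ⁅x, y⁆ = LieAlgebra.ad K g x * LieAlgebra.ad K g y -
      LieAlgebra.ad K g y * LieAlgebra.ad K g x := LinearMap.ext fun w => lie_lie x y w
  have hcomm {a b : g} (hab : ⁅a, b⁆ = 0) :
      Commute (LieAlgebra.ad K g a) (LieAlgebra.ad K g b) := LinearMap.ext fun w => by
    have := leibniz_lie a b w
    rwa [hab, zero_lie, zero_add] at this
  have hnil : IsNilpotent (LieAlgebra.ad K g ⁅x, y⁆) := by
    have := isNilpotent_lie_of_commute (LieAlgebra.ad K g x) (LieAlgebra.ad K g y)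
      (by rw [← hbr]; exact hcomm hxy)
    rwa [← hbr] at this
  have h1 : killingForm K g h ⁅x, y⁆ = 0 := by
    rw [killingForm_apply_apply]
    exact (LinearMap.isNilpotent_trace_of_isNilpotent
      ((hcomm hz).isNilpotent_mul_left hnil)).eq_zero
  rw [← LieModule.traceForm_apply_lie_apply, hx, map_smul, LinearMap.smul_apply,
    smul_eq_mul] at h1
  exact (mul_eq_zero.1 h1).resolve_left hr

/-- The Killing form pairs `g(1)` and `g(-1)` nondegenerately, so that a subspace of `g(1)` is
determined by its annihilator in `g(-1)`. -/
theorem IsShortGrading.mem_of_killingForm (hs : IsShortGrading 𝒢) [CharZero K]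
    [FiniteDimensional K g] [LieAlgebra.IsSimple K g] {W : Submodule K g} (hW : W ≤ 𝒢 1) {u : g}
    (hu : u ∈ 𝒢 1)
    (h : ∀ y ∈ 𝒢 (-1), (∀ w ∈ W, killingForm K g w y = 0) → killingForm K g u y = 0) :
    u ∈ W := by
  obtain ⟨h₀, -, hh⟩ := hs.exists_gradingElement
  by_contra huW
  obtain ⟨φ, hφu, hφ⟩ := Submodule.exists_le_ker_of_notMem huW
  obtain ⟨a, rfl⟩ : ∃ a, killingForm K g a = φ :=
    (LinearMap.BilinForm.toDual (killingForm K g)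
      (LieAlgebra.IsKilling.killingForm_nondegenerate K g)).surjective φ
  have hκ {w : g} (hw : w ∈ 𝒢 1) :
      killingForm K g w (gradingProj 𝒢 (-1) a) = killingForm K g a w := by
    conv_rhs => rw [LieModule.traceForm_comm, hs.eq_gradingProj a]
    rw [map_add, map_add, killingForm_eq_zero_of_ne hh hw (gradingProj_mem 0 a) (by decide),
      killingForm_eq_zero_of_ne hh hw (gradingProj_mem 1 a) (by decide), add_zero, add_zero]
  refine hφu ?_
  rw [← hκ hu]
  refine h _ (gradingProj_mem _ a) fun w hw => ?_
  rw [hκ (hW hw)]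
  exact hφ hw

theorem IsShortGrading.eq_zero_of_killingForm (hs : IsShortGrading 𝒢) [CharZero K]
    [FiniteDimensional K g] [LieAlgebra.IsSimple K g] {i : ℤ} {x : g} (hx : x ∈ 𝒢 i)
    (h : ∀ y ∈ 𝒢 (-i), killingForm K g x y = 0) : x = 0 := by
  obtain ⟨h₀, -, hh⟩ := hs.exists_gradingElement
  have hcomp {j : ℤ} {y : g} (hy : y ∈ 𝒢 j) : killingForm K g x y = 0 := by
    by_cases hij : i + j = 0
    · obtain rfl : j = -i := by omega
      exact h y hy
    · exact killingForm_eq_zero_of_ne hh hx hy hij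
  have hker : x ∈ LinearMap.ker (killingForm K g) := by
    refine LinearMap.ext fun y => ?_
    obtain ⟨a, ha, b, hb, c, hc, rfl⟩ := hs.exists_eq_add y
    rw [map_add, map_add, hcomp ha, hcomp hb, hcomp hc]
    simp
  simpa using hker

/-- If `y` in `g(-1)` satisfies `[y, [y, g(1)]] = 0`, then `y = 0`. -/
theorem IsShortGrading.eq_zero_of_lie_lie (hs : IsShortGrading 𝒢) [CharZero K]
    [FiniteDimensional K g] [LieAlgebra.IsSimple K g] {y : g} (hy : y ∈ 𝒢 (-1))
    (h : ∀ u ∈ 𝒢 1, ⁅y, ⁅y, u⁆⁆ = 0) : y = 0 := by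
  obtain ⟨h₀, -, hh⟩ := hs.exists_gradingElement
  refine hs.eq_zero_of_killingForm hy fun u hu => ?_
  exact killingForm_eq_zero_of_lie_lie (neg_ne_zero.2 one_ne_zero) (by simpa using hh _ y hy)
    (by simpa using hh 0 _ (lie_mem_grading hy hu rfl)) (h u hu)

end Killing

/-! ### The tangent space of the dense orbit -/

section Orbit

variable {K : Type*} {g : Type*} [Field K] [LieRing g] [LieAlgebra K g]

theorem map_lie_of_mem_adjointGroup [CharZero K] {φ : g ≃ₗ[K] g} (hφ : φ ∈ adjointGroup K g)
    (x y : g) : φ ⁅x, y⁆ = ⁅φ x, φ y⁆ := by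
  induction hφ using Subgroup.closure_induction generalizing x y with
  | mem φ h =>
    obtain ⟨a, n, hn, hφ⟩ := h
    let _ : Module ℚ g := Module.compHom g (algebraMap ℚ K)
    let _ : LieAlgebra ℚ g :=
      { lie_smul := fun t x y => lie_smul (algebraMap ℚ K t) x y }
    have had : (LieDerivation.ad K g a).toLinearMap = LieAlgebra.ad K g a :=
      LieDerivation.coe_ad_apply_eq_ad_apply a
    have hnil : IsNilpotent (LieDerivation.ad K g a).toLinearMap := ⟨n, by rw [had, hn]⟩
    have h1 (x : g) : φ x = LieDerivation.exp (LieDerivation.ad K g a) hnil x := by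
      rw [LieDerivation.exp_map_apply, had, IsNilpotent.exp_eq_sum (k := n) hn]
      have := LinearMap.congr_fun hφ x
      simp only [LinearEquiv.coe_coe, LinearMap.sum_apply, LinearMap.smul_apply] at this ⊢
      rw [this]
      refine Finset.sum_congr rfl fun i _ => ?_
      change _ = (algebraMap ℚ K (i.factorial : ℚ)⁻¹) • (LieAlgebra.ad K g a ^ i) x
      simp
    rw [h1, h1, h1, LieEquiv.map_lie]
  | one => rfl
  | mul φ ψ _ _ h1 h2 => rw [LinearEquiv.mul_apply, h2, h1]; rfl
  | inv φ _ h =>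
    apply φ.injective
    rw [h]
    simp

theorem det_mem_polynomialFunctions {V ι : Type*} [AddCommGroup V] [Module K V] [Fintype ι]
    [DecidableEq ι] (M : ι → ι → Module.Dual K V) :
    (fun v => Matrix.det (Matrix.of fun i j => M i j v)) ∈ polynomialFunctions K V := by
  have : (fun v => Matrix.det (Matrix.of fun i j => M i j v)) =
      ∑ σ : Equiv.Perm ι, ((Equiv.Perm.sign σ : ℤ) : K) • ∏ i, (M (σ i) i : V → K) := by
    ext v
    simp [Matrix.det_apply']
  rw [this]
  refine Subalgebra.sum_mem _ fun σ _ => Subalgebra.smul_mem _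
    (Subalgebra.prod_mem _ fun i _ => ?_) _
  exact Algebra.subset_adjoin ⟨_, rfl⟩

variable {𝒢 : ℤ → Submodule K g}

/-- The rank of `ad v : g(0) → g(1)` is constant on the orbit of `e`, so by density it is maximal
at `v = e`. Differentiating the vanishing minors at `e` in the direction `u` shows that the
centraliser of `e` in `g(0)` maps every `u` in `g(1)` into `[g(0), e]`. -/
theorem InDenseOrbit.lie_mem [CharZero K] [FiniteDimensional K g] {e : 𝒢 1}
    (he : InDenseOrbit 𝒢 e) {z u : g} (hz : z ∈ 𝒢 0) (hze : ⁅z, (e : g)⁆ = 0) (hu : u ∈ 𝒢 1) :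
    ⁅z, u⁆ ∈ (𝒢 0).map (LieAlgebra.ad K g (e : g) : g →ₗ[K] g) := by
  classical
  set W := (𝒢 0).map (LieAlgebra.ad K g (e : g) : g →ₗ[K] g)
  by_contra hzu
  set r := Module.finrank K W
  let b : Module.Basis (Fin r) K W := Module.finBasis K W
  have hb (i : Fin r) : ∃ x ∈ 𝒢 0, ⁅x, (e : g)⁆ = b i := by
    obtain ⟨x, hx, hxe⟩ := (b i).2
    refine ⟨-x, neg_mem hx, ?_⟩
    rw [neg_lie, lie_skew, ← hxe]; rfl
  choose x hx hxe using hb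
  -- The vectors `[x i, e]` and `[z, u]` are independent; `Ψ` takes them to the standard basis.
  let v : Option (Fin r) → g := fun o => o.elim ⁅z, u⁆ fun i => b i
  have hv : LinearIndependent K v := by
    refine linearIndependent_option.2 ⟨?_, ?_⟩
    · exact b.linearIndependent.map' W.subtype (Submodule.ker_subtype W)
    · intro h
      apply hzu
      refine Submodule.span_le.2 ?_ h
      rintro _ ⟨i, rfl⟩
      exact (b i).2
  obtain ⟨Ψ, hΨ⟩ := LinearMap.exists_leftInverse_of_injective (Fintype.linearCombination K v)
    (LinearMap.ker_eq_bot.2 (linearIndependent_iff_injective_fintypeLinearCombination.1 hv))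
  have hΨv (o : Option (Fin r)) : Ψ (v o) = Pi.single o 1 := by
    have := LinearMap.congr_fun hΨ (Pi.single o 1)
    simpa [Fintype.linearCombination_apply_single] using this
  let y : Option (Fin r) → g := fun o => o.elim z x
  have hy (o : Option (Fin r)) : y o ∈ 𝒢 0 := by
    cases o with
    | none => exact hz
    | some i => exact hx i
  let M : Option (Fin r) → Option (Fin r) → Module.Dual K (𝒢 1) := fun i j =>
    LinearMap.proj j ∘ₗ Ψ ∘ₗ (LieAlgebra.ad K g (y i) : g →ₗ[K] g) ∘ₗ (𝒢 1).subtype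
  have hM (w : 𝒢 1) (i j : Option (Fin r)) : M i j w = Ψ ⁅y i, (w : g)⁆ j := rfl
  -- The minor vanishes on the orbit of `e`, hence everywhere.
  have hdet := he _ (det_mem_polynomialFunctions M) (by
    rintro w ⟨φ, ⟨hφ, hφ'⟩, hφe⟩
    by_contra hne
    have h1 : LinearIndependent K fun i => Ψ ⁅y i, (w : g)⁆ :=
      Matrix.linearIndependent_rows_of_det_ne_zero hne
    have h2 : LinearIndependent K fun i => ⁅y i, (w : g)⁆ := LinearIndependent.of_comp Ψ h1
    have h3 (i : Option (Fin r)) : φ⁻¹ ⁅y i, (w : g)⁆ ∈ W := by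
      rw [map_lie_of_mem_adjointGroup (inv_mem hφ), ← hφe, ← LinearEquiv.mul_apply,
        inv_mul_cancel, ← lie_skew]
      refine neg_mem ⟨_, ?_, rfl⟩
      rw [SetLike.mem_coe, ← hφ' 0, ← LinearEquiv.mul_apply, mul_inv_cancel]
      exact hy i
    have h4 : LinearIndependent K fun i => (⟨_, h3 i⟩ : W) := by
      refine LinearIndependent.of_comp W.subtype ?_
      exact h2.map' (φ⁻¹ : g ≃ₗ[K] g).toLinearMap (LinearEquiv.ker _)
    have h5 := h4.fintype_card_le_finrank
    simp [r] at h5)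
  -- At `e + t u`, the minor is `t` times a polynomial in `t` with constant term `1`.
  let N : Matrix (Option (Fin r)) (Option (Fin r)) K := Matrix.of fun i =>
    i.elim 0 fun i => Ψ ⁅x i, u⁆
  have hroot (t : K) (ht : t ≠ 0) : Matrix.det (1 + t • N) = 0 := by
    have h1 := hdet (e + t • ⟨u, hu⟩)
    have h2 : (Matrix.of fun i j => M i j (e + t • ⟨u, hu⟩)) =
        Matrix.updateRow (1 + t • N) none (t • (1 + t • N) none) := by
      ext i j
      rw [Matrix.of_apply, hM]
      cases i with
      | none =>
        have h3 : Ψ ⁅z, u⁆ = Pi.single none 1 := hΨv none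
        simp [y, N, hze, h3, Matrix.one_apply, Pi.single_apply, eq_comm]
      | some i =>
        have h3 : Ψ (b i : g) = Pi.single (some i) 1 := hΨv (some i)
        simp [y, N, hxe, h3, Matrix.one_apply, Pi.single_apply, eq_comm]
    rw [h2, Matrix.det_updateRow_smul, Matrix.updateRow_eq_self] at h1
    exact (mul_eq_zero.1 h1).resolve_left ht
  let p : Polynomial K := Matrix.det (1 + (Polynomial.X : Polynomial K) • N.map Polynomial.C)
  have hp (t : K) : p.eval t = Matrix.det (1 + t • N) := by
    rw [← Polynomial.coe_evalRingHom, RingHom.map_det]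
    congr 1
    ext i j
    by_cases hij : i = j <;> simp [hij, mul_comm t]
  have hp0 : p = 0 := by
    refine Polynomial.eq_zero_of_infinite_isRoot p (Set.Infinite.mono (s := {0}ᶜ) ?_ ?_)
    · intro t ht
      exact (hp t).trans (hroot t ht)
    · exact Set.Finite.infinite_compl (Set.finite_singleton 0)
  have h0 := hp 0
  simp [hp0] at h0

variable [GradedLieAlgebra 𝒢]

/-- The tangent space of the dense orbit is everything: `[g(0), e] = g(1)`. Equivalently, `ad e` is
injective on `g(-1)`. -/
theorem InDenseOrbit.eq_zero_of_lie_eq_zero [CharZero K] [FiniteDimensional K g]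
    [LieAlgebra.IsSimple K g] (hs : IsShortGrading 𝒢) {e : 𝒢 1} (he : InDenseOrbit 𝒢 e) {y : g}
    (hy : y ∈ 𝒢 (-1)) (hey : ⁅(e : g), y⁆ = 0) : y = 0 := by
  refine hs.eq_zero_of_lie_lie hy fun u hu => ?_
  -- `[u, y]` centralises `e`, so it maps `g(1)` into `[g(0), e]`, which is orthogonal to `y`.
  have hye : ⁅y, (e : g)⁆ = 0 := by rw [← lie_skew, hey, neg_zero]
  have hyu : ⁅y, u⁆ ∈ 𝒢 0 := lie_mem_grading hy hu rfl
  have hcent : ⁅⁅y, u⁆, (e : g)⁆ = 0 := by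
    rw [lie_lie, hs.lie_one_one hu e.2, hye, lie_zero, lie_zero, sub_zero]
  refine hs.eq_zero_of_killingForm (lie_mem_grading (k := -1) hy hyu rfl) fun c hc => ?_
  obtain ⟨w, hw, hwe⟩ := he.lie_mem hyu hcent hc
  have h1 : killingForm K g ⁅y, ⁅y, u⁆⁆ c = killingForm K g y ⁅⁅y, u⁆, c⁆ :=
    LieModule.traceForm_apply_lie_apply K g g _ _ _
  have h2 : killingForm K g ⁅y, (e : g)⁆ w = killingForm K g y ⁅(e : g), w⁆ :=
    LieModule.traceForm_apply_lie_apply K g g _ _ _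
  rw [hye, map_zero, LinearMap.zero_apply] at h2
  rw [h1, ← hwe]
  exact h2.symm

end Orbit

/-! ### The `𝔰𝔩₂`-triple of a generic element with reductive centraliser -/

section Triple

variable {K : Type*} {g : Type*} [Field K] [LieRing g] [LieAlgebra K g]

/-- An `𝔰𝔩₂`-triple `(e, h, f)` with `e` in `g(1)` and `f` in `g(-1)` whose semisimple element `h`
is twice the element defining the grading. -/
structure IsGradedTriple (𝒢 : ℤ → Submodule K g) (e f h : g) : Prop where
  e_mem : e ∈ 𝒢 1
  f_mem : f ∈ 𝒢 (-1)
  lie_e_f : ⁅e, f⁆ = h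
  lie_h : ∀ (i : ℤ), ∀ x ∈ 𝒢 i, ⁅h, x⁆ = (2 * (i : K)) • x

variable {𝒢 : ℤ → Submodule K g}

namespace IsGradedTriple

variable {e f h : g} (t : IsGradedTriple 𝒢 e f h)
include t

theorem lie_h_e : ⁅h, e⁆ = (2 : K) • e := by simpa using t.lie_h 1 e t.e_mem

theorem lie_h_zero {x : g} (hx : x ∈ 𝒢 0) : ⁅h, x⁆ = 0 := by simpa using t.lie_h 0 x hx

theorem lie_h_neg {x : g} (hx : x ∈ 𝒢 (-1)) : ⁅h, x⁆ = -((2 : K) • x) := by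
  simpa using t.lie_h (-1) x hx

theorem lie_h_one {x : g} (hx : x ∈ 𝒢 1) : ⁅h, x⁆ = (2 : K) • x := by
  simpa using t.lie_h 1 x hx

theorem lie_f_e : ⁅f, e⁆ = -h := by rw [← lie_skew, t.lie_e_f]

end IsGradedTriple

variable [GradedLieAlgebra 𝒢]

/-- Let `[[e, f], e] = 2e` and `y` in `g(-1)` with `[e, [e, y]] = 0`. Then `[e, y]` has weight `1`
with respect to `[e, f]`. -/
theorem IsShortGrading.lie_lie_eq_self (hs : IsShortGrading 𝒢) [CharZero K] {e f y : g}
    (hf : f ∈ 𝒢 (-1)) (hef : ⁅⁅e, f⁆, e⁆ = (2 : K) • e) (hy : y ∈ 𝒢 (-1))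
    (hey : ⁅e, ⁅e, y⁆⁆ = 0) : ⁅⁅e, f⁆, ⁅e, y⁆⁆ = ⁅e, y⁆ := by
  have h1 : ⁅⁅e, f⁆, y⁆ = -⁅f, ⁅e, y⁆⁆ := by
    rw [lie_lie, hs.lie_neg_neg hf hy, lie_zero, zero_sub]
  have h2 : ⁅⁅e, f⁆, ⁅e, y⁆⁆ = ⁅e, ⁅f, ⁅e, y⁆⁆⁆ := by
    rw [lie_lie, hey, lie_zero, sub_zero]
  have h3 : ⁅⁅e, f⁆, ⁅e, y⁆⁆ = (2 : K) • ⁅e, y⁆ + ⁅e, ⁅⁅e, f⁆, y⁆⁆ := by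
    rw [leibniz_lie ⁅e, f⁆ e y, hef, smul_lie]
  rw [h1, lie_neg, ← h2] at h3
  linear_combination (norm := module) (1 / 2 : K) • h3

/-- Let `[[e, f], e] = 2e` and `y` in `g(-1)`. Then `[e, [e, y]]` has weight `2` with respect to
`[e, f]`. -/
theorem IsShortGrading.lie_lie_lie (hs : IsShortGrading 𝒢) [CharZero K] {e f y : g}
    (he : e ∈ 𝒢 1) (hf : f ∈ 𝒢 (-1)) (hef : ⁅⁅e, f⁆, e⁆ = (2 : K) • e) (hy : y ∈ 𝒢 (-1)) :
    ⁅⁅e, f⁆, ⁅e, ⁅e, y⁆⁆⁆ = (2 : K) • ⁅e, ⁅e, y⁆⁆ := by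
  have hx : ⁅e, y⁆ ∈ 𝒢 0 := lie_mem_grading he hy rfl
  have hw : ⁅e, ⁅e, ⁅e, y⁆⁆⁆ = 0 := hs.lie_one_one he (lie_mem_grading he hx rfl)
  have h1 : ⁅⁅e, f⁆, y⁆ = -⁅f, ⁅e, y⁆⁆ := by
    rw [lie_lie, hs.lie_neg_neg hf hy, lie_zero, zero_sub]
  have h2 : ⁅⁅e, f⁆, ⁅e, y⁆⁆ = ⁅e, ⁅f, ⁅e, y⁆⁆⁆ - ⁅f, ⁅e, ⁅e, y⁆⁆⁆ := lie_lie _ _ _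
  have h3 : ⁅⁅e, f⁆, ⁅e, y⁆⁆ = (2 : K) • ⁅e, y⁆ + ⁅e, ⁅⁅e, f⁆, y⁆⁆ := by
    rw [leibniz_lie ⁅e, f⁆ e y, hef, smul_lie]
  have h4 : ⁅⁅e, f⁆, ⁅e, ⁅e, y⁆⁆⁆ = (2 : K) • ⁅e, ⁅e, y⁆⁆ + ⁅e, ⁅⁅e, f⁆, ⁅e, y⁆⁆⁆ := by
    rw [leibniz_lie ⁅e, f⁆ e, hef, smul_lie]
  have h5 : ⁅⁅e, f⁆, ⁅e, ⁅e, y⁆⁆⁆ = ⁅e, ⁅f, ⁅e, ⁅e, y⁆⁆⁆⁆ := by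
    rw [lie_lie, hw, lie_zero, sub_zero]
  rw [h1, lie_neg] at h3
  have h6 : ⁅e, (2 : K) • ⁅⁅e, f⁆, ⁅e, y⁆⁆⁆ = ⁅e, (2 : K) • ⁅e, y⁆ - ⁅f, ⁅e, ⁅e, y⁆⁆⁆⁆ := by
    congr 1
    linear_combination (norm := module) h2 + h3
  rw [lie_smul, lie_sub, lie_smul, ← h5] at h6
  linear_combination (norm := module) (1 / 3 : K) • h6 + (2 / 3 : K) • h4

variable [CharZero K] [FiniteDimensional K g] [LieAlgebra.IsSimple K g]

/-- `(ad e)² : g(-1) → g(1)` is self-adjoint for the Killing form, so its image is the annihilator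
of its kernel. -/
theorem IsShortGrading.exists_lie_lie_eq (hs : IsShortGrading 𝒢) {e u : g} (he : e ∈ 𝒢 1)
    (hu : u ∈ 𝒢 1) (h : ∀ y ∈ 𝒢 (-1), ⁅e, ⁅e, y⁆⁆ = 0 → killingForm K g u y = 0) :
    ∃ y ∈ 𝒢 (-1), ⁅e, ⁅e, y⁆⁆ = u := by
  have hmem (y : g) (hy : y ∈ 𝒢 (-1)) : ⁅e, ⁅e, y⁆⁆ ∈ 𝒢 1 :=
    lie_mem_grading he (lie_mem_grading (k := 0) he hy rfl) rfl
  have key : u ∈ (𝒢 (-1)).map (LieAlgebra.ad K g e ∘ₗ LieAlgebra.ad K g e : g →ₗ[K] g) := by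
    refine hs.mem_of_killingForm ?_ hu fun y hy hWy => h y hy ?_
    · rintro _ ⟨y, hy, rfl⟩
      exact hmem y hy
    · refine hs.eq_zero_of_killingForm (hmem y hy) fun y' hy' => ?_
      have h1 : killingForm K g ⁅e, ⁅e, y'⁆⁆ y = 0 := hWy _ ⟨y', hy', rfl⟩
      have h2 (a b : g) : killingForm K g ⁅e, a⁆ b = -killingForm K g a ⁅e, b⁆ := by
        rw [← LieModule.traceForm_apply_lie_apply, ← lie_skew e a, map_neg, LinearMap.neg_apply]
      rw [h2, h2, neg_neg] at h1
      rw [LieModule.traceForm_comm, h1]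
  obtain ⟨y, hy, hyu⟩ := key
  exact ⟨y, hy, hyu⟩

/-- The radical of the Killing form of `g` restricted to `𝔨` is `𝔨 ∩ 𝔪`. This is an abelian ideal
of `𝔨` on which `[e, f] - 2h₀`, an element of `𝔨`, acts as the identity. When the radical of `𝔨`
is central, this ideal vanishes; equivalently, `(ad e)²` is injective on `g(-1)`. -/
theorem IsShortGrading.eq_zero_of_hasCentralRadical (hs : IsShortGrading 𝒢) {e : 𝒢 1}
    (he : InDenseOrbit 𝒢 e) (hred : LieAlgebra.HasCentralRadical K (zeroCentralizer 𝒢 e))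
    {f : g} (hf : f ∈ 𝒢 (-1)) (hef : ⁅⁅(e : g), f⁆, (e : g)⁆ = (2 : K) • (e : g)) {y : g}
    (hy : y ∈ 𝒢 (-1)) (hey : ⁅(e : g), ⁅(e : g), y⁆⁆ = 0) : y = 0 := by
  obtain ⟨h₀, hh₀, hh⟩ := hs.exists_gradingElement
  have hc : ⁅(e : g), f⁆ - (2 : K) • h₀ ∈ zeroCentralizer 𝒢 e := by
    refine ⟨sub_mem (lie_mem_grading e.2 hf rfl) (Submodule.smul_mem _ _ hh₀), ?_⟩
    rw [sub_lie, hef, smul_lie, hh 1 _ e.2]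
    simp
  have hweight {x y : g} (hy : y ∈ 𝒢 (-1)) (hxy : ⁅(e : g), y⁆ = x) (hx : ⁅x, (e : g)⁆ = 0) :
      ⁅⁅(e : g), f⁆, x⁆ = x := by
    rw [← hxy]
    refine hs.lie_lie_eq_self hf hef hy ?_
    rw [hxy, ← lie_skew, hx, neg_zero]
  let n : LieIdeal K (zeroCentralizer 𝒢 e) :=
    { carrier := {x | ∃ y ∈ 𝒢 (-1), ⁅(e : g), y⁆ = x}
      add_mem' := by
        rintro x x' ⟨y, hy, h⟩ ⟨y', hy', h'⟩
        exact ⟨y + y', add_mem hy hy', by rw [lie_add, h, h']; rfl⟩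
      zero_mem' := ⟨0, zero_mem _, lie_zero _⟩
      smul_mem' := by
        rintro c x ⟨y, hy, h⟩
        exact ⟨c • y, Submodule.smul_mem _ _ hy, by rw [lie_smul, h]; rfl⟩
      lie_mem := by
        rintro z x ⟨y, hy, h⟩
        refine ⟨⁅(z : g), y⁆, lie_mem_grading z.2.1 hy rfl, ?_⟩
        rw [leibniz_lie, ← lie_skew (e : g) (z : g), z.2.2, neg_zero, zero_lie, zero_add, h]
        rfl }
  have hn (x : zeroCentralizer 𝒢 e) (hx : x ∈ n) : ⁅⁅(e : g), f⁆, (x : g)⁆ = x := by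
    obtain ⟨y, hy, h⟩ := hx
    exact hweight hy h x.2.2
  have hab : IsLieAbelian n := by
    refine ⟨fun x x' => ?_⟩
    have h1 := hn _ (lie_mem_right K _ n x.1 x'.1 x'.2)
    have h2 : ⁅⁅(e : g), f⁆, ⁅(x.1 : g), (x'.1 : g)⁆⁆ =
        ⁅(x.1 : g), (x'.1 : g)⁆ + ⁅(x.1 : g), (x'.1 : g)⁆ := by
      rw [leibniz_lie, hn _ x.2, hn _ x'.2]
    rw [LieSubalgebra.coe_bracket, h2] at h1
    ext
    simpa using h1
  have hle : n ≤ LieAlgebra.center K (zeroCentralizer 𝒢 e) := by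
    rw [← hred.radical_eq_center]
    exact (LieAlgebra.LieIdeal.solvable_iff_le_radical K _ n).1 inferInstance
  have hx0 : ⁅(e : g), y⁆ ∈ 𝒢 0 := lie_mem_grading e.2 hy rfl
  have hxk : ⁅(e : g), y⁆ ∈ zeroCentralizer 𝒢 e := ⟨hx0, by rw [← lie_skew, hey, neg_zero]⟩
  have hcen : (⟨_, hxk⟩ : zeroCentralizer 𝒢 e) ∈ LieAlgebra.center K (zeroCentralizer 𝒢 e) :=
    hle ⟨y, hy, rfl⟩
  have h1 := congrArg Subtype.val (hcen ⟨_, hc⟩)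
  have h2 : ⁅⁅(e : g), f⁆ - (2 : K) • h₀, ⁅(e : g), y⁆⁆ = 0 := h1
  rw [sub_lie, smul_lie, hh 0 _ hx0, hweight hy rfl hxk.2] at h2
  refine he.eq_zero_of_lie_eq_zero hs hy ?_
  simpa using h2

/-- A generic `e` whose centraliser in `g(0)` is reductive is part of an `𝔰𝔩₂`-triple whose
semisimple element defines the grading. -/
theorem exists_isGradedTriple (hs : IsShortGrading 𝒢) {e : 𝒢 1}
    (he : InDenseOrbit 𝒢 e) (hred : LieAlgebra.HasCentralRadical K (zeroCentralizer 𝒢 e)) :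
    ∃ f h : g, IsGradedTriple 𝒢 (e : g) f h := by
  obtain ⟨h₀, hh₀, hh⟩ := hs.exists_gradingElement
  -- `f` exists because `κ(e, y) = 0` whenever `[e, [e, y]] = 0`.
  obtain ⟨f, hf, hef⟩ := hs.exists_lie_lie_eq (u := (-2 : K) • (e : g)) e.2
    (Submodule.smul_mem _ _ e.2) fun y hy hey => by
      rw [map_smul, LinearMap.smul_apply, killingForm_eq_zero_of_lie_lie one_ne_zero
        (by simpa using hh 1 _ e.2) (by simpa using hh 0 _ (lie_mem_grading e.2 hy rfl)) hey,
        smul_zero]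
  replace hef : ⁅⁅(e : g), f⁆, (e : g)⁆ = (2 : K) • (e : g) := by
    rw [← lie_skew, hef]; module
  have hc0 : ⁅(e : g), f⁆ - (2 : K) • h₀ ∈ 𝒢 0 :=
    sub_mem (lie_mem_grading e.2 hf rfl) (Submodule.smul_mem _ _ hh₀)
  -- `[e, f] = 2h₀`: the difference lies in `g(0)` and kills `g(1)`, hence also its dual `g(-1)`.
  have hc1 (w : g) (hw : w ∈ 𝒢 1) : ⁅⁅(e : g), f⁆ - (2 : K) • h₀, w⁆ = 0 := by
    obtain ⟨y, hy, rfl⟩ := hs.exists_lie_lie_eq (u := w) e.2 hw fun y hy hey => by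
      rw [hs.eq_zero_of_hasCentralRadical he hred hf hef hy hey, map_zero]
    rw [sub_lie, hs.lie_lie_lie e.2 hf hef hy, smul_lie, hh 1 _ hw]
    simp
  have hc2 (y : g) (hy : y ∈ 𝒢 (-1)) : ⁅⁅(e : g), f⁆ - (2 : K) • h₀, y⁆ = 0 := by
    refine hs.eq_zero_of_killingForm (lie_mem_grading (k := -1) hc0 hy rfl) fun w hw => ?_
    rw [← lie_skew, map_neg, LinearMap.neg_apply, LieModule.traceForm_apply_lie_apply,
      hc1 w (by simpa using hw), map_zero, neg_zero]
  have hc := hs.eq_zero_of_lie_eq_zero hc0 hc1 hc2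
  refine ⟨f, _, e.2, hf, rfl, fun i x hx => ?_⟩
  rw [sub_eq_zero.1 hc, smul_lie, hh i x hx, smul_smul]

end Triple

/-! ### Construction of the involutions -/

section Involutions

variable {K : Type*} {g : Type*} [Field K] [LieRing g] [LieAlgebra K g]

theorem exists_lieEquiv_exp [CharZero K] (a : g) (ha : ∀ x : g, ⁅a, ⁅a, ⁅a, x⁆⁆⁆ = 0) :
    ∃ φ : g ≃ₗ⁅K⁆ g, ∀ x, φ x = x + ⁅a, x⁆ + (1 / 2 : K) • ⁅a, ⁅a, x⁆⁆ := by
  let _ : Module ℚ g := Module.compHom g (algebraMap ℚ K)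
  let _ : LieAlgebra ℚ g :=
    { lie_smul := fun t x y => lie_smul (algebraMap ℚ K t) x y }
  have had : (LieDerivation.ad K g a).toLinearMap = LieAlgebra.ad K g a :=
    LieDerivation.coe_ad_apply_eq_ad_apply a
  have hn : LieAlgebra.ad K g a ^ 3 = 0 := LinearMap.ext fun x => by
    simpa [pow_succ] using ha x
  have hnil : IsNilpotent (LieDerivation.ad K g a).toLinearMap := ⟨3, by rw [had, hn]⟩
  refine ⟨LieDerivation.exp (LieDerivation.ad K g a) hnil, fun x => ?_⟩
  rw [LieDerivation.exp_map_apply, had, IsNilpotent.exp_eq_sum hn]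
  have hsmul (q : ℚ) (y : g) : q • y = (q : K) • y := rfl
  simp [Finset.sum_range_succ, hsmul, Nat.factorial, pow_succ]

variable {𝒢 : ℤ → Submodule K g} [GradedLieAlgebra 𝒢]

/-- The automorphism acting on `g(i)` as `(-1)^i`. -/
theorem IsShortGrading.exists_parity (hs : IsShortGrading 𝒢) :
    ∃ σ : g ≃ₗ⁅K⁆ g, (∀ x ∈ 𝒢 0, σ x = x) ∧ (∀ x ∈ 𝒢 1, σ x = -x) ∧ ∀ x ∈ 𝒢 (-1), σ x = -x := by
  let s : g →ₗ[K] g := gradingProj 𝒢 0 - gradingProj 𝒢 1 - gradingProj 𝒢 (-1)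
  have s0 {x : g} (hx : x ∈ 𝒢 0) : s x = x := by
    simp [s, gradingProj_same hx, gradingProj_ne hx (show (0 : ℤ) ≠ 1 by decide),
      gradingProj_ne hx (show (0 : ℤ) ≠ -1 by decide)]
  have s1 {x : g} (hx : x ∈ 𝒢 1) : s x = -x := by
    simp [s, gradingProj_same hx, gradingProj_ne hx (show (1 : ℤ) ≠ 0 by decide),
      gradingProj_ne hx (show (1 : ℤ) ≠ -1 by decide)]
  have s2 {x : g} (hx : x ∈ 𝒢 (-1)) : s x = -x := by
    simp [s, gradingProj_same hx, gradingProj_ne hx (show (-1 : ℤ) ≠ 0 by decide),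
      gradingProj_ne hx (show (-1 : ℤ) ≠ 1 by decide)]
  have hinv (x : g) : s (s x) = x := by
    obtain ⟨a, ha, b, hb, c, hc, rfl⟩ := hs.exists_eq_add x
    simp only [map_add, s0 hb, s1 hc, s2 ha, map_neg, neg_neg]
  have hlie (x y : g) : s ⁅x, y⁆ = ⁅s x, s y⁆ := by
    obtain ⟨a, ha, b, hb, c, hc, rfl⟩ := hs.exists_eq_add x
    obtain ⟨a', ha', b', hb', c', hc', rfl⟩ := hs.exists_eq_add y
    simp only [map_add, add_lie, lie_add, s0 hb, s1 hc, s2 ha, s0 hb', s1 hc', s2 ha',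
      hs.lie_neg_neg ha ha', hs.lie_one_one hc hc', s0 (lie_mem_grading hb hb' rfl),
      s0 (lie_mem_grading (k := 0) ha hc' rfl), s0 (lie_mem_grading (k := 0) hc ha' rfl),
      s1 (lie_mem_grading (k := 1) hb hc' rfl), s1 (lie_mem_grading (k := 1) hc hb' rfl),
      s2 (lie_mem_grading (k := -1) hb ha' rfl), s2 (lie_mem_grading (k := -1) ha hb' rfl),
      neg_lie, lie_neg, map_zero]
    abel
  let σ : g ≃ₗ⁅K⁆ g :=
    { toLinearMap := s
      map_lie' := fun {x y} => hlie x y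
      invFun := s
      left_inv := hinv
      right_inv := hinv }
  exact ⟨σ, fun _ => s0, fun _ => s1, fun _ => s2⟩

namespace IsGradedTriple

variable {e f h : g}

section

variable (t : IsGradedTriple 𝒢 e f h)
include t

theorem lie_mem {y : g} (hy : y ∈ 𝒢 (-1)) : ⁅e, y⁆ ∈ 𝒢 0 := lie_mem_grading t.e_mem hy rfl

theorem lie_lie_mem {y : g} (hy : y ∈ 𝒢 (-1)) : ⁅e, ⁅e, y⁆⁆ ∈ 𝒢 1 :=
  lie_mem_grading t.e_mem (t.lie_mem hy) rfl

variable (hs : IsShortGrading 𝒢)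
include hs

theorem lie_f_lie {y : g} (hy : y ∈ 𝒢 (-1)) : ⁅f, ⁅e, y⁆⁆ = (2 : K) • y := by
  rw [leibniz_lie, t.lie_f_e, neg_lie, t.lie_h_neg hy, hs.lie_neg_neg t.f_mem hy, lie_zero,
    add_zero, neg_neg]

theorem lie_f_lie_lie {y : g} (hy : y ∈ 𝒢 (-1)) : ⁅f, ⁅e, ⁅e, y⁆⁆⁆ = (2 : K) • ⁅e, y⁆ := by
  rw [leibniz_lie, t.lie_f_e, neg_lie, t.lie_h_zero (t.lie_mem hy), t.lie_f_lie hs hy, lie_smul,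
    neg_zero, zero_add]

theorem lie_lie_lie {y : g} (hy : y ∈ 𝒢 (-1)) : ⁅e, ⁅e, ⁅e, y⁆⁆⁆ = 0 :=
  hs.lie_one_one t.e_mem (t.lie_lie_mem hy)

theorem eq_zero_of_lie [CharZero K] {y : g} (hy : y ∈ 𝒢 (-1)) (h0 : ⁅e, y⁆ = 0) : y = 0 := by
  have := t.lie_f_lie hs hy
  rw [h0, lie_zero] at this
  exact (smul_eq_zero.1 this.symm).resolve_left two_ne_zero

theorem lie_lie_f_of_mem_one {w : g} (hw : w ∈ 𝒢 1) : ⁅e, ⁅f, w⁆⁆ = (2 : K) • w := by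
  rw [leibniz_lie, t.lie_e_f, t.lie_h_one hw, hs.lie_one_one t.e_mem hw, lie_zero, add_zero]

/-- `(ad e)² : g(-1) → g(1)` is onto, because `(ad e)² (ad f)² = 4` on `g(1)`. -/
theorem exists_lie_lie_eq [CharZero K] {w : g} (hw : w ∈ 𝒢 1) :
    ∃ y ∈ 𝒢 (-1), ⁅e, ⁅e, y⁆⁆ = w := by
  have hfw : ⁅f, w⁆ ∈ 𝒢 0 := lie_mem_grading t.f_mem hw rfl
  refine ⟨(1 / 4 : K) • ⁅f, ⁅f, w⁆⁆,
    Submodule.smul_mem _ _ (lie_mem_grading t.f_mem hfw rfl), ?_⟩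
  have h1 : ⁅e, ⁅f, ⁅f, w⁆⁆⁆ = (2 : K) • ⁅f, w⁆ := by
    rw [leibniz_lie, t.lie_e_f, t.lie_h_zero hfw, t.lie_lie_f_of_mem_one hs hw, lie_smul, zero_add]
  rw [lie_smul, lie_smul, h1, lie_smul, t.lie_lie_f_of_mem_one hs hw, smul_smul, smul_smul]
  norm_num

/-- The decomposition `g(0) = 𝔨 ⊕ 𝔪`. -/
theorem exists_eq_add_lie [CharZero K] {z : g} (hz : z ∈ 𝒢 0) :
    ∃ k ∈ 𝒢 0, ⁅k, e⁆ = 0 ∧ ∃ y ∈ 𝒢 (-1), z = k + ⁅e, y⁆ := by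
  obtain ⟨y, hy, hyz⟩ := t.exists_lie_lie_eq hs (lie_mem_grading (k := 1) t.e_mem hz rfl)
  refine ⟨z - ⁅e, y⁆, sub_mem hz (t.lie_mem hy), ?_, y, hy, by abel⟩
  rw [← lie_skew, lie_sub, hyz, sub_self, neg_zero]

theorem lie_f_eq_zero [CharZero K] {z : g} (hz : z ∈ 𝒢 0) (hze : ⁅z, e⁆ = 0) : ⁅f, z⁆ = 0 := by
  refine t.eq_zero_of_lie hs (lie_mem_grading t.f_mem hz rfl) ?_
  rw [leibniz_lie, t.lie_e_f, t.lie_h_zero hz, ← lie_skew e, hze, neg_zero, lie_zero, zero_add]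

/-- The composite of the parity automorphism with the Weyl group element
`exp (ad e) exp (-ad f) exp (ad e)`. -/
theorem exists_weyl [CharZero K] : ∃ σ : g ≃ₗ⁅K⁆ g,
    (∀ z ∈ 𝒢 0, ⁅z, e⁆ = 0 → σ z = z) ∧
    (∀ y ∈ 𝒢 (-1), σ ⁅e, y⁆ = -⁅e, y⁆) ∧
    (∀ y ∈ 𝒢 (-1), σ y = -(1 / 2 : K) • ⁅e, ⁅e, y⁆⁆) ∧
    ∀ y ∈ 𝒢 (-1), σ ⁅e, ⁅e, y⁆⁆ = -(2 : K) • y := by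
  obtain ⟨s, s0, s1, s2⟩ := hs.exists_parity
  obtain ⟨E, hE⟩ := exists_lieEquiv_exp (K := K) e fun x => by
    obtain ⟨a, ha, b, hb, c, hc, rfl⟩ := hs.exists_eq_add x
    have hb' : ⁅e, b⁆ ∈ 𝒢 1 := lie_mem_grading t.e_mem hb rfl
    simp only [lie_add, t.lie_lie_lie hs ha, hs.lie_one_one t.e_mem hb',
      hs.lie_one_one t.e_mem hc, add_zero]
  obtain ⟨F, hF⟩ := exists_lieEquiv_exp (K := K) (-f) fun x => by
    obtain ⟨a, ha, b, hb, c, hc, rfl⟩ := hs.exists_eq_add x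
    have hb' : ⁅f, b⁆ ∈ 𝒢 (-1) := lie_mem_grading t.f_mem hb rfl
    have hc' : ⁅f, ⁅f, c⁆⁆ ∈ 𝒢 (-1) :=
      lie_mem_grading t.f_mem (lie_mem_grading (k := 0) t.f_mem hc rfl) rfl
    simp only [lie_add, neg_lie, lie_neg, hs.lie_neg_neg t.f_mem ha, hs.lie_neg_neg t.f_mem hb',
      hs.lie_neg_neg t.f_mem hc', lie_zero, add_zero, neg_zero]
  have E0 {y : g} (hy : y ∈ 𝒢 (-1)) : E y = y + ⁅e, y⁆ + (1 / 2 : K) • ⁅e, ⁅e, y⁆⁆ := hE y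
  have E1 {y : g} (hy : y ∈ 𝒢 (-1)) : E ⁅e, y⁆ = ⁅e, y⁆ + ⁅e, ⁅e, y⁆⁆ := by
    rw [hE, t.lie_lie_lie hs hy, smul_zero, add_zero]
  have E2 {y : g} (hy : y ∈ 𝒢 (-1)) : E ⁅e, ⁅e, y⁆⁆ = ⁅e, ⁅e, y⁆⁆ := by
    rw [hE, t.lie_lie_lie hs hy, lie_zero, smul_zero, add_zero, add_zero]
  have F0 {y : g} (hy : y ∈ 𝒢 (-1)) : F y = y := by
    simp [hF, hs.lie_neg_neg t.f_mem hy]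
  have F1 {y : g} (hy : y ∈ 𝒢 (-1)) : F ⁅e, y⁆ = ⁅e, y⁆ - (2 : K) • y := by
    simp [hF, t.lie_f_lie hs hy, hs.lie_neg_neg t.f_mem hy, sub_eq_add_neg]
  have F2 {y : g} (hy : y ∈ 𝒢 (-1)) :
      F ⁅e, ⁅e, y⁆⁆ = ⁅e, ⁅e, y⁆⁆ - (2 : K) • ⁅e, y⁆ + (2 : K) • y := by
    rw [hF]
    simp only [neg_lie, lie_neg, t.lie_f_lie_lie hs hy, lie_smul, t.lie_f_lie hs hy]
    module
  refine ⟨s.trans (E.trans (F.trans E)), fun z hz hze => ?_, fun y hy => ?_, fun y hy => ?_,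
    fun y hy => ?_⟩ <;> simp only [LieEquiv.trans_apply]
  · have hez : ⁅e, z⁆ = 0 := by rw [← lie_skew, hze, neg_zero]
    have h1 : E z = z := by simp [hE, hez]
    have h2 : F z = z := by simp [hF, t.lie_f_eq_zero hs hz hze]
    rw [s0 z hz, h1, h2, h1]
  · rw [s0 _ (t.lie_mem hy), E1 hy, map_add, F1 hy, F2 hy]
    simp only [map_add, map_sub, map_smul, E0 hy, E1 hy, E2 hy]
    module
  · rw [s2 y hy, map_neg, E0 hy]
    simp only [map_neg, map_add, map_sub, map_smul, F0 hy, F1 hy, F2 hy, E0 hy, E1 hy, E2 hy]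
    module
  · rw [s1 _ (t.lie_lie_mem hy), map_neg, E2 hy]
    simp only [map_neg, map_add, map_sub, map_smul, F2 hy, E0 hy, E1 hy, E2 hy]
    module

end

theorem nonempty_jordanTriad [CharZero K] (hs : IsShortGrading 𝒢) {e : 𝒢 1}
    (t : IsGradedTriple 𝒢 (e : g) f h) : Nonempty (JordanTriad 𝒢 e) := by
  obtain ⟨s, s0, s1, s2⟩ := hs.exists_parity
  obtain ⟨σ, hk, hm, hy, hw⟩ := t.exists_weyl hs
  -- Additive maps agree once they agree on `𝔨`, `𝔪`, `g(-1)` and `(ad e)² g(-1)`.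
  have hspan {φ ψ : g → g} (hφ : ∀ x y, φ (x + y) = φ x + φ y) (hψ : ∀ x y, ψ (x + y) = ψ x + ψ y)
      (h0 : ∀ z ∈ 𝒢 0, ⁅z, (e : g)⁆ = 0 → φ z = ψ z)
      (h1 : ∀ y ∈ 𝒢 (-1), φ ⁅(e : g), y⁆ = ψ ⁅(e : g), y⁆) (h2 : ∀ y ∈ 𝒢 (-1), φ y = ψ y)
      (h3 : ∀ y ∈ 𝒢 (-1), φ ⁅(e : g), ⁅(e : g), y⁆⁆ = ψ ⁅(e : g), ⁅(e : g), y⁆⁆) (x : g) :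
      φ x = ψ x := by
    obtain ⟨a, ha, b, hb, c, hc, rfl⟩ := hs.exists_eq_add x
    obtain ⟨z, hz, hze, y, hy, rfl⟩ := t.exists_eq_add_lie hs hb
    obtain ⟨y', hy', rfl⟩ := t.exists_lie_lie_eq hs hc
    simp only [hφ, hψ, h0 z hz hze, h1 y hy, h2 a ha, h3 y' hy']
  exact ⟨{
    h := h
    h_mem := by rw [← t.lie_e_f]; exact t.lie_mem t.f_mem
    mem_iff := hs.mem_iff_of_lie two_ne_zero t.lie_h
    f := f
    f_mem := t.f_mem
    lie_e_f := t.lie_e_f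
    σ₁ := s
    σ₂ := σ
    σ₃ := σ.trans s
    σ₁_zero := s0
    σ₁_one := s1
    σ₁_neg_one := s2
    σ₂_invol := hspan (by simp) (by simp)
      (fun z hz hze => by rw [hk z hz hze, hk z hz hze])
      (fun y hy' => by rw [hm y hy', map_neg, hm y hy', neg_neg])
      (fun y hy' => by rw [hy y hy', map_smul, hw y hy', smul_smul]; norm_num)
      (fun y hy' => by rw [hw y hy', map_smul, hy y hy', smul_smul]; norm_num)
    σ₂_centralizer := hk
    σ₂_mSubspace := by
      rintro _ ⟨y, hy', rfl⟩
      exact hm y hy'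
    σ₂_e := by
      have h1 : ⁅(e : g), ⁅(e : g), f⁆⁆ = -((2 : K) • (e : g)) := by
        rw [t.lie_e_f, ← lie_skew, t.lie_h_e]
      have h2 := hw f t.f_mem
      rw [h1, map_neg, map_smul, neg_smul, neg_inj] at h2
      exact smul_right_injective g (two_ne_zero (α := K)) h2
    σ_comm := hspan (by simp) (by simp)
      (fun z hz hze => by rw [hk z hz hze, s0 z hz, hk z hz hze])
      (fun y hy' => by rw [hm y hy', map_neg, s0 _ (t.lie_mem hy'), hm y hy'])
      (fun y hy' => by
        rw [hy y hy', map_smul, s1 _ (t.lie_lie_mem hy'), s2 y hy', map_neg, hy y hy', smul_neg])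
      (fun y hy' => by
        rw [hw y hy', map_smul, s1 _ (t.lie_lie_mem hy'), s2 y hy', map_neg, hw y hy', smul_neg])
    σ₃_eq := fun x => rfl }⟩

end IsGradedTriple

end Involutions

/-! ### The quaternionic decomposition -/

section Quaternionic

variable {K : Type*} {g : Type*} [Field K] [LieRing g] [LieAlgebra K g]
variable {𝒢 : ℤ → Submodule K g} {e : 𝒢 1}

theorem JordanTriad.isGradedTriple (T : JordanTriad 𝒢 e) :
    IsGradedTriple 𝒢 (e : g) T.f T.h :=
  ⟨e.2, T.f_mem, T.lie_e_f, fun i x hx => (T.mem_iff i x).1 hx⟩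

theorem JordanTriad.σ₂_f (T : JordanTriad 𝒢 e) : T.σ₂ T.f = e := by
  rw [← T.σ₂_e, T.σ₂_invol]

theorem JordanTriad.σ₂_lie (T : JordanTriad 𝒢 e) {y : g} (hy : y ∈ 𝒢 (-1)) :
    T.σ₂ ⁅(e : g), y⁆ = -⁅(e : g), y⁆ := T.σ₂_mSubspace _ ⟨y, hy, rfl⟩

theorem JordanTriad.σ₂_mem (T : JordanTriad 𝒢 e) {i j : ℤ} (hij : j = -i) {x : g}
    (hx : x ∈ 𝒢 i) : T.σ₂ x ∈ 𝒢 j := by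
  subst hij
  have hh : T.σ₂ T.h = -T.h := by
    rw [← T.lie_e_f, LieEquiv.map_lie, T.σ₂_e, T.σ₂_f, lie_skew]
  rw [T.mem_iff] at hx ⊢
  have h1 := congrArg T.σ₂ hx
  rw [LieEquiv.map_lie, hh, map_smul, neg_lie] at h1
  rw [← neg_neg ⁅T.h, T.σ₂ x⁆, h1]
  push_cast
  module

variable [GradedLieAlgebra 𝒢]

theorem JordanTriad.lie_lie_f (T : JordanTriad 𝒢 e) (hs : IsShortGrading 𝒢) {y : g}
    (hy : y ∈ 𝒢 (-1)) : ⁅⁅(e : g), y⁆, T.f⁆ = -((2 : K) • y) := by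
  rw [← lie_skew, T.isGradedTriple.lie_f_lie hs hy]

variable [CharZero K]

theorem JordanTriad.σ₁_eq_self_iff (T : JordanTriad 𝒢 e) (hs : IsShortGrading 𝒢) (x : g) :
    T.σ₁ x = x ↔ x ∈ 𝒢 0 := by
  refine ⟨fun hx => ?_, T.σ₁_zero x⟩
  obtain ⟨a, ha, b, hb, c, hc, rfl⟩ := hs.exists_eq_add x
  rw [map_add, map_add, T.σ₁_neg_one a ha, T.σ₁_zero b hb, T.σ₁_one c hc] at hx
  have h1 : a + c = 0 := by linear_combination (norm := module) (-1 / 2 : K) • hx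
  have h2 : a + b + c = b := by linear_combination (norm := module) h1
  rwa [h2]

theorem JordanTriad.σ₁_eq_neg_iff (T : JordanTriad 𝒢 e) (hs : IsShortGrading 𝒢) (x : g) :
    T.σ₁ x = -x ↔ ∃ a ∈ 𝒢 (-1), ∃ c ∈ 𝒢 1, x = a + c := by
  constructor
  · intro hx
    obtain ⟨a, ha, b, hb, c, hc, rfl⟩ := hs.exists_eq_add x
    rw [map_add, map_add, T.σ₁_neg_one a ha, T.σ₁_zero b hb, T.σ₁_one c hc] at hx
    have h1 : b = 0 := by linear_combination (norm := module) (1 / 2 : K) • hx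
    exact ⟨a, ha, c, hc, by rw [h1, add_zero]⟩
  · rintro ⟨a, ha, c, hc, rfl⟩
    rw [map_add, T.σ₁_neg_one a ha, T.σ₁_one c hc, neg_add]

theorem JordanTriad.quaternionicPart_zero_one (T : JordanTriad 𝒢 e) (hs : IsShortGrading 𝒢) :
    quaternionicPart T.σ₁ T.σ₂ 0 1 = mSubspace 𝒢 e := by
  ext x
  constructor
  · rintro ⟨h1, h2⟩
    rw [pow_zero, one_smul, T.σ₁_eq_self_iff hs] at h1
    obtain ⟨z, hz, hze, y, hy, rfl⟩ := T.isGradedTriple.exists_eq_add_lie hs h1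
    rw [map_add, T.σ₂_centralizer z hz hze, T.σ₂_lie hy,
      pow_one] at h2
    have h3 : z = 0 := by linear_combination (norm := module) (1 / 2 : K) • h2
    exact ⟨y, hy, by rw [h3, zero_add]; rfl⟩
  · intro hx
    refine ⟨?_, by rw [T.σ₂_mSubspace x hx]; simp⟩
    obtain ⟨y, hy, rfl⟩ := hx
    rw [pow_zero, one_smul, T.σ₁_eq_self_iff hs]
    exact T.isGradedTriple.lie_mem hy

/-- The elements of `g(-1) ⊕ g(1)` on which `σ₂` acts as a sign `ε` are the `[z, e - ε f]` with
`z` in `𝔪`: such an element is determined by its component in `g(1) = [𝔪, e]`. -/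
theorem JordanTriad.mem_quaternionicPart_iff (T : JordanTriad 𝒢 e) (hs : IsShortGrading 𝒢) {j : ℕ}
    {ε : K} (hε : (-1 : K) ^ j = ε) (x : g) :
    x ∈ quaternionicPart T.σ₁ T.σ₂ 1 j ↔
      ∃ y ∈ 𝒢 (-1), x = ⁅⁅(e : g), y⁆, (e : g) - ε • T.f⁆ := by
  have hεε : ε * ε = 1 := by rw [← hε, ← mul_pow]; simp
  constructor
  · rintro ⟨h1, h2⟩
    rw [pow_one, neg_one_smul, T.σ₁_eq_neg_iff hs] at h1
    obtain ⟨a, ha, c, hc, rfl⟩ := h1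
    obtain ⟨y, hy, hyc⟩ := T.isGradedTriple.exists_lie_lie_eq hs (neg_mem hc)
    have hc' : c = ⁅⁅(e : g), y⁆, (e : g)⁆ := by rw [← lie_skew, hyc, neg_neg]
    have hσc : T.σ₂ c = -⁅⁅(e : g), y⁆, T.f⁆ := by
      rw [hc', LieEquiv.map_lie, T.σ₂_e, T.σ₂_lie hy,
        neg_lie]
    have hσ : T.σ₂ c = ε • a := by
      have h3 := congrArg (gradingProj 𝒢 (-1)) h2
      rwa [map_add, map_add, map_smul, map_add, gradingProj_ne (T.σ₂_mem (j := 1) rfl ha)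
        (by decide), gradingProj_same (T.σ₂_mem rfl hc), gradingProj_same ha,
        gradingProj_ne hc (by decide), zero_add, add_zero, hε] at h3
    refine ⟨y, hy, ?_⟩
    have ha' : a = -(ε • ⁅⁅(e : g), y⁆, T.f⁆) := by
      rw [← smul_neg, ← hσc, hσ, smul_smul, hεε, one_smul]
    rw [lie_sub, lie_smul, ← hc', sub_eq_add_neg, ← ha', add_comm]
  · rintro ⟨y, hy, rfl⟩
    have hm := T.isGradedTriple.lie_mem hy
    constructor
    · rw [LieEquiv.map_lie, map_sub, map_smul, T.σ₁_zero _ hm, T.σ₁_one _ e.2,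
        T.σ₁_neg_one _ T.f_mem, lie_sub, lie_sub, lie_smul, lie_smul, lie_neg, lie_neg]
      module
    · rw [LieEquiv.map_lie, map_sub, map_smul, T.σ₂_e, T.σ₂_f, T.σ₂_lie hy,
        lie_sub, lie_sub, lie_smul, lie_smul, neg_lie, neg_lie, hε, smul_sub,
        smul_smul, hεε]
      module

theorem JordanTriad.quaternionicPart_one (T : JordanTriad 𝒢 e) (hs : IsShortGrading 𝒢) {j : ℕ}
    {ε : K} (hε : (-1 : K) ^ j = ε) :
    quaternionicPart T.σ₁ T.σ₂ 1 j =
      (mSubspace 𝒢 e).map (LieAlgebra.ad K g ((e : g) - ε • T.f) : g →ₗ[K] g) := by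
  ext x
  rw [T.mem_quaternionicPart_iff hs hε]
  constructor
  · rintro ⟨y, hy, rfl⟩
    refine ⟨_, neg_mem (⟨y, hy, rfl⟩ : ⁅(e : g), y⁆ ∈ mSubspace 𝒢 e), ?_⟩
    rw [LieAlgebra.ad_apply, lie_neg, lie_skew]
  · rintro ⟨_, ⟨y, hy, rfl⟩, rfl⟩
    refine ⟨-y, neg_mem hy, ?_⟩
    rw [lie_neg, neg_lie, lie_skew]
    rfl

end Quaternionic

/-! ### The commuting varieties -/

section Varieties

variable {K V W : Type*} [Field K] [AddCommGroup V] [Module K V] [AddCommGroup W] [Module K W]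

theorem comp_mem_polynomialFunctions (L : V →ₗ[K] W) {q : W → K}
    (hq : q ∈ polynomialFunctions K W) : q ∘ L ∈ polynomialFunctions K V := by
  induction hq using Algebra.adjoin_induction with
  | mem q hq =>
    obtain ⟨φ, rfl⟩ := hq
    exact Algebra.subset_adjoin ⟨φ ∘ₗ L, rfl⟩
  | algebraMap r => exact Subalgebra.algebraMap_mem _ r
  | add p q _ _ hp hq => exact add_mem hp hq
  | mul p q _ _ hp hq => exact mul_mem hp hq

theorem areIsomorphicVarieties_of_linearEquiv (L : V ≃ₗ[K] W) {X : Set V} {Y : Set W}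
    (h : ∀ v, v ∈ X ↔ L v ∈ Y) : AreIsomorphicVarieties K X Y := by
  refine ⟨L.toEquiv.subtypeEquiv h, fun q hq => ?_, fun q hq => ?_⟩
  · exact ⟨_, comp_mem_polynomialFunctions L.toLinearMap hq, fun _ => rfl⟩
  · exact ⟨_, comp_mem_polynomialFunctions L.symm.toLinearMap hq, fun _ => rfl⟩

variable {g : Type*} [LieRing g] [LieAlgebra K g] {𝒢 : ℤ → Submodule K g}
variable [GradedLieAlgebra 𝒢]

theorem IsShortGrading.lie_lie_comm (hs : IsShortGrading 𝒢) (e : g) {x y : g} (hx : x ∈ 𝒢 (-1))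
    (hy : y ∈ 𝒢 (-1)) : ⁅x, ⁅e, y⁆⁆ = ⁅y, ⁅e, x⁆⁆ := by
  rw [leibniz_lie x e y, hs.lie_neg_neg hx hy, lie_zero, add_zero, ← lie_skew, ← lie_skew x e,
    lie_neg, neg_neg]

/-- The expansion of `(ad e)² [x, y] = 0`. -/
theorem IsShortGrading.lie_lie_lie_add (hs : IsShortGrading 𝒢) (e : g) {x y : g}
    (hx : x ∈ 𝒢 (-1)) (hy : y ∈ 𝒢 (-1)) :
    ⁅⁅e, ⁅e, x⁆⁆, y⁆ + (2 : K) • ⁅⁅e, x⁆, ⁅e, y⁆⁆ + ⁅x, ⁅e, ⁅e, y⁆⁆⁆ = 0 := by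
  have h1 : ⁅e, ⁅e, ⁅x, y⁆⁆⁆ = 0 := by rw [hs.lie_neg_neg hx hy, lie_zero, lie_zero]
  rw [leibniz_lie e x y, lie_add, leibniz_lie e _ y, leibniz_lie e x] at h1
  rw [← h1]
  module

/-- The difference of the outer terms in the expansion of `(ad e)² [x, y] = 0` is a multiple of
`[e, x ∘ y]`. -/
theorem IsShortGrading.lie_lie_lie_sub (hs : IsShortGrading 𝒢) (e : g) {x y : g}
    (hx : x ∈ 𝒢 (-1)) (hy : y ∈ 𝒢 (-1)) :
    ⁅⁅e, ⁅e, x⁆⁆, y⁆ - ⁅x, ⁅e, ⁅e, y⁆⁆⁆ = -((2 : K) • ⁅e, ⁅x, ⁅e, y⁆⁆⁆) := by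
  have h1 := hs.lie_lie_lie_add (K := K) e hx hy
  rw [leibniz_lie e x]
  linear_combination (norm := module) h1

/-- The bracket `𝔤₁₀ × 𝔤₁₁ → 𝔪` and the Jordan product correspond to each other. -/
theorem JordanTriad.lie_lie_eq [CharZero K] {e : 𝒢 1} (T : JordanTriad 𝒢 e)
    (hs : IsShortGrading 𝒢) {x y : g} (hx : x ∈ 𝒢 (-1)) (hy : y ∈ 𝒢 (-1)) :
    ⁅⁅⁅(e : g), x⁆, (e : g) - T.f⁆, ⁅⁅(e : g), y⁆, (e : g) + T.f⁆⁆ =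
      -((4 : K) • ⁅(e : g), ⁅x, ⁅(e : g), y⁆⁆⁆) := by
  have h1 := hs.lie_lie_lie_sub (K := K) (e : g) hx hy
  rw [lie_sub, lie_add, T.lie_lie_f hs hx, T.lie_lie_f hs hy, ← lie_skew _ (e : g),
    ← lie_skew _ (e : g)]
  simp only [sub_lie, lie_add, neg_lie, lie_neg, lie_smul, smul_lie, hs.lie_neg_neg hx hy,
    hs.lie_one_one (T.isGradedTriple.lie_lie_mem hx) (T.isGradedTriple.lie_lie_mem hy)]
  linear_combination (norm := module) (2 : K) • h1

/-- The linear isomorphism `y ↦ [[e, y], e - ε f]` from `g(-1)` to `g₁ⱼ`, where `ε = (-1)ʲ`. -/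
noncomputable def JordanTriad.toQuaternionicPart [CharZero K] {e : 𝒢 1} (T : JordanTriad 𝒢 e)
    (hs : IsShortGrading 𝒢) {j : ℕ} {ε : K} (hε : (-1 : K) ^ j = ε) :
    JordanPart 𝒢 e ≃ₗ[K] quaternionicPart T.σ₁ T.σ₂ 1 j :=
  LinearEquiv.ofBijective
    { toFun := fun y => ⟨⁅⁅(e : g), JordanPart.val y⁆, (e : g) - ε • T.f⁆,
        (T.mem_quaternionicPart_iff hs hε _).2 ⟨_, JordanPart.val_mem y, rfl⟩⟩
      map_add' := fun x y => Subtype.ext (by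
        simp only [map_add, lie_add, add_lie, Submodule.coe_add])
      map_smul' := fun c x => Subtype.ext (by
        simp only [map_smul, lie_smul, smul_lie, Submodule.coe_smul, RingHom.id_apply]) }
    (by
      have hε0 : ε ≠ 0 := by rw [← hε]; exact pow_ne_zero _ (by simp)
      constructor
      · refine (injective_iff_map_eq_zero _).2 fun y hy => ?_
        have hm := JordanPart.val_mem y
        have h1 : ⁅⁅(e : g), JordanPart.val y⁆, (e : g) - ε • T.f⁆ = 0 := congrArg Subtype.val hy
        rw [lie_sub, lie_smul, T.lie_lie_f hs hm] at h1
        have h2 := congrArg (gradingProj 𝒢 (-1)) h1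
        rw [map_sub, gradingProj_ne (i := 1) (lie_mem_grading (i := 0) (T.isGradedTriple.lie_mem hm)
          e.2 rfl) (by decide), gradingProj_same (Submodule.smul_mem _ _
          (neg_mem (Submodule.smul_mem _ _ hm))), map_zero, zero_sub, smul_neg, neg_neg,
          smul_smul] at h2
        exact JordanPart.val_injective ((smul_eq_zero.1 h2).resolve_left
          (mul_ne_zero hε0 two_ne_zero))
      · rintro ⟨x, hx⟩
        obtain ⟨y, hy, rfl⟩ := (T.mem_quaternionicPart_iff hs hε x).1 hx
        exact ⟨(⟨y, hy⟩ : 𝒢 (-1)), rfl⟩)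

theorem JordanTriad.areIsomorphicVarieties [CharZero K] {e : 𝒢 1} (T : JordanTriad 𝒢 e)
    (hs : IsShortGrading 𝒢) :
    AreIsomorphicVarieties K (commutingVariety (JordanPart 𝒢 e))
      {p | commutatorMap T.σ₁ T.σ₂ p = 0} := by
  refine areIsomorphicVarieties_of_linearEquiv (LinearEquiv.prodCongr
    (T.toQuaternionicPart hs (pow_zero _)) (T.toQuaternionicPart hs (pow_one _))) ?_
  rintro ⟨x, y⟩
  have h1 : ((commutatorMap T.σ₁ T.σ₂ (T.toQuaternionicPart hs (pow_zero _) x,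
      T.toQuaternionicPart hs (pow_one _) y) : quaternionicPart T.σ₁ T.σ₂ 0 1) : g) =
      -((4 : K) • ⁅(e : g), JordanPart.val (x * y)⁆) := by
    rw [JordanPart.val_mul, ← T.lie_lie_eq hs (JordanPart.val_mem x) (JordanPart.val_mem y)]
    change ⁅⁅_, (e : g) - (1 : K) • T.f⁆, ⁅_, (e : g) - (-1 : K) • T.f⁆⁆ = _
    rw [one_smul, neg_one_smul, sub_neg_eq_add]
  change x * y = 0 ↔ commutatorMap T.σ₁ T.σ₂ (T.toQuaternionicPart hs (pow_zero _) x,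
      T.toQuaternionicPart hs (pow_one _) y) = 0
  rw [← Subtype.coe_inj, h1]
  constructor
  · intro hxy
    simp [hxy]
  · intro hxy
    rw [Submodule.coe_zero, neg_eq_zero] at hxy
    exact JordanPart.val_injective (T.isGradedTriple.eq_zero_of_lie hs (JordanPart.val_mem _)
      ((smul_eq_zero.1 hxy).resolve_left (by norm_num)))

end Varieties

/-! ### The Jordan algebra -/

section Jordan

variable {K : Type*} {g : Type*} [Field K] [LieRing g] [LieAlgebra K g]
variable {𝒢 : ℤ → Submodule K g}

theorem JordanPart.exists_val_eq {e : 𝒢 1} {y : g} (hy : y ∈ 𝒢 (-1)) :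
    ∃ a : JordanPart 𝒢 e, JordanPart.val a = y :=
  ⟨(⟨y, hy⟩ : 𝒢 (-1)), rfl⟩

variable [GradedLieAlgebra 𝒢]

/-- The identity behind the Jordan identity: the multiplications by `x` and by `x ∘ x` are induced
by commuting elements of `𝔪`. -/
theorem IsShortGrading.lie_lie_sq (hs : IsShortGrading 𝒢) [CharZero K] {e x : g} (he : e ∈ 𝒢 1)
    (hx : x ∈ 𝒢 (-1)) : ⁅⁅e, x⁆, ⁅e, ⁅x, ⁅e, x⁆⁆⁆⁆ = 0 := by
  have hz : ⁅e, x⁆ ∈ 𝒢 0 := lie_mem_grading he hx rfl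
  have hq : ⁅x, ⁅e, x⁆⁆ ∈ 𝒢 (-1) := lie_mem_grading hx hz rfl
  have hw : ⁅e, ⁅e, ⁅e, x⁆⁆⁆ = 0 := hs.lie_one_one he (lie_mem_grading he hz rfl)
  have h1 : ⁅e, ⁅x, ⁅e, x⁆⁆⁆ = ⁅x, ⁅e, ⁅e, x⁆⁆⁆ := by
    rw [leibniz_lie, lie_self, zero_add]
  have h2 : ⁅e, ⁅e, ⁅x, ⁅e, x⁆⁆⁆⁆ = ⁅⁅e, x⁆, ⁅e, ⁅e, x⁆⁆⁆ := by
    rw [h1, leibniz_lie, hw, lie_zero, add_zero]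
  have h3 : ⁅⁅e, x⁆, ⁅e, ⁅x, ⁅e, x⁆⁆⁆⁆ =
      ⁅⁅e, ⁅e, x⁆⁆, ⁅x, ⁅e, x⁆⁆⁆ + ⁅x, ⁅e, ⁅e, ⁅x, ⁅e, x⁆⁆⁆⁆⁆ := by
    rw [h2, h1, leibniz_lie, ← lie_skew ⁅e, x⁆ x, neg_lie, lie_skew]
  have h4 := hs.lie_lie_lie_add (K := K) e hx hq
  linear_combination (norm := module) (1 / 3 : K) • h3 + (1 / 3 : K) • h4

namespace JordanPart

variable {e : 𝒢 1}

theorem mul_comm_of_isShortGrading (hs : IsShortGrading 𝒢) (x y : JordanPart 𝒢 e) :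
    x * y = y * x :=
  val_injective (by
    rw [val_mul, val_mul, hs.lie_lie_comm _ (val_mem x) (val_mem y)])

theorem val_mul' (hs : IsShortGrading 𝒢) (x y : JordanPart 𝒢 e) :
    val (x * y) = -⁅⁅(e : g), val x⁆, val y⁆ := by
  rw [mul_comm_of_isShortGrading hs, val_mul, lie_skew]

theorem jordan_identity (hs : IsShortGrading 𝒢) [CharZero K] (x y : JordanPart 𝒢 e) :
    (x * y) * (x * x) = x * (y * (x * x)) := by
  have h1 : ⁅⁅(e : g), val x⁆, ⁅(e : g), val (x * x)⁆⁆ = 0 := hs.lie_lie_sq e.2 (val_mem x)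
  apply val_injective
  rw [mul_comm_of_isShortGrading hs (x * y), mul_comm_of_isShortGrading hs y,
    val_mul' hs (x * x) (x * y), val_mul' hs x y, val_mul' hs x (x * x * y),
    val_mul' hs (x * x) y, lie_neg, lie_neg, neg_neg, neg_neg, leibniz_lie ⁅(e : g), val x⁆, h1,
    zero_lie, zero_add]

end JordanPart

/-- `g(-1)` is an irreducible `g(0)`-module: a submodule `N` generates the ideal
`N + [g(1), N] + [g(1), [g(1), N]]`, whose component of degree `-1` is `N`. -/
theorem IsShortGrading.eq_bot_or_le [LieAlgebra.IsSimple K g] (hs : IsShortGrading 𝒢)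
    {N : Submodule K g} (hN : N ≤ 𝒢 (-1)) (hstab : ∀ z ∈ 𝒢 0, ∀ n ∈ N, ⁅z, n⁆ ∈ N) :
    N = ⊥ ∨ 𝒢 (-1) ≤ N := by
  set S : Set g := {x | x ∈ N ∨ (∃ a ∈ 𝒢 1, ∃ n ∈ N, x = ⁅a, n⁆) ∨
    ∃ a ∈ 𝒢 1, ∃ b ∈ 𝒢 1, ∃ n ∈ N, x = ⁅a, ⁅b, n⁆⁆}
  set J := Submodule.span K S
  have hJ0 {n : g} (hn : n ∈ N) : n ∈ J := Submodule.subset_span (Or.inl hn)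
  have hJ1 {a n : g} (ha : a ∈ 𝒢 1) (hn : n ∈ N) : ⁅a, n⁆ ∈ J :=
    Submodule.subset_span (Or.inr (Or.inl ⟨a, ha, n, hn, rfl⟩))
  have hJ2 {a b n : g} (ha : a ∈ 𝒢 1) (hb : b ∈ 𝒢 1) (hn : n ∈ N) : ⁅a, ⁅b, n⁆⁆ ∈ J :=
    Submodule.subset_span (Or.inr (Or.inr ⟨a, ha, b, hb, n, hn, rfl⟩))
  have hlie : ∀ x : g, ∀ s ∈ J, ⁅x, s⁆ ∈ J := by
    intro x s hs'
    induction hs' using Submodule.span_induction with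
    | mem s hs' =>
      obtain ⟨p, hp, q, hq, r, hr, rfl⟩ := hs.exists_eq_add x
      rcases hs' with hn | ⟨a, ha, n, hn, rfl⟩ | ⟨a, ha, b, hb, n, hn, rfl⟩
      · rw [add_lie, add_lie, hs.lie_neg_neg hp (hN hn), zero_add]
        exact add_mem (hJ0 (hstab q hq _ hn)) (hJ1 hr hn)
      · -- `[g(-1), [g(1), N]] ⊆ [g(0), N] ⊆ N`
        have hpa {p a n : g} (hp : p ∈ 𝒢 (-1)) (ha : a ∈ 𝒢 1) (hn : n ∈ N) : ⁅p, ⁅a, n⁆⁆ ∈ N := by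
          rw [leibniz_lie, hs.lie_neg_neg hp (hN hn), lie_zero, add_zero]
          exact hstab _ (lie_mem_grading hp ha rfl) _ hn
        rw [add_lie, add_lie, leibniz_lie q]
        exact add_mem (add_mem (hJ0 (hpa hp ha hn)) (add_mem
          (hJ1 (lie_mem_grading hq ha rfl) hn) (hJ1 ha (hstab q hq n hn)))) (hJ2 hr ha hn)
      · have hp2 : ⁅p, ⁅a, ⁅b, n⁆⁆⁆ ∈ J := by
          have hpa : ⁅p, a⁆ ∈ 𝒢 0 := lie_mem_grading hp ha rfl
          have hpb : ⁅p, b⁆ ∈ 𝒢 0 := lie_mem_grading hp hb rfl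
          rw [leibniz_lie p, leibniz_lie ⁅p, a⁆, leibniz_lie p b, hs.lie_neg_neg hp (hN hn),
            lie_zero, add_zero]
          exact add_mem (add_mem (hJ1 (lie_mem_grading hpa hb rfl) hn) (hJ1 hb (hstab _ hpa _ hn)))
            (hJ1 ha (hstab _ hpb _ hn))
        have hq2 : ⁅q, ⁅a, ⁅b, n⁆⁆⁆ ∈ J := by
          rw [leibniz_lie q, leibniz_lie q b, lie_add]
          exact add_mem (hJ2 (lie_mem_grading hq ha rfl) hb hn)
            (add_mem (hJ2 ha (lie_mem_grading hq hb rfl) hn) (hJ2 ha hb (hstab q hq n hn)))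
        have hr2 : ⁅r, ⁅a, ⁅b, n⁆⁆⁆ = 0 :=
          hs.lie_one_one hr (lie_mem_grading ha (lie_mem_grading (k := 0) hb (hN hn) rfl) rfl)
        rw [add_lie, add_lie, hr2, add_zero]
        exact add_mem hp2 hq2
    | zero => simp
    | add s t _ _ h1 h2 => rw [lie_add]; exact add_mem h1 h2
    | smul c s _ h => rw [lie_smul]; exact Submodule.smul_mem _ c h
  have hproj : ∀ s ∈ J, gradingProj 𝒢 (-1) s ∈ N := by
    intro s hs'
    induction hs' using Submodule.span_induction with
    | mem s hs' =>
      rcases hs' with hn | ⟨a, ha, n, hn, rfl⟩ | ⟨a, ha, b, hb, n, hn, rfl⟩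
      · rwa [gradingProj_same (hN hn)]
      · rw [gradingProj_ne (i := 0) (lie_mem_grading ha (hN hn) rfl) (by decide)]
        exact zero_mem _
      · rw [gradingProj_ne (i := 1) (lie_mem_grading ha (lie_mem_grading (k := 0) hb (hN hn) rfl)
          rfl) (by decide)]
        exact zero_mem _
    | zero => simp
    | add s t _ _ h1 h2 => rw [map_add]; exact add_mem h1 h2
    | smul c s _ h => rw [map_smul]; exact Submodule.smul_mem _ c h
  let I : LieIdeal K g := { J with lie_mem := fun {x s} h => hlie x s h }
  rcases LieAlgebra.IsSimple.eq_bot_or_eq_top (R := K) I with h | h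
  · left
    refine (Submodule.eq_bot_iff _).2 fun n hn => ?_
    have : n ∈ I := hJ0 hn
    simpa [h] using this
  · right
    intro y hy
    have hyI : y ∈ I := by rw [h]; trivial
    have := hproj y hyI
    rwa [gradingProj_same hy] at this

variable [CharZero K] {e : 𝒢 1} {f h : g}

/-- An ideal of the Jordan algebra is stable under `g(0) = 𝔪 + [𝔪, 𝔪]`, since `𝔪` acts on `g(-1)`
by the multiplication operators; so it is trivial by irreducibility of `g(-1)`. -/
theorem IsGradedTriple.isSimpleJordan [LieAlgebra.IsSimple K g] (hs : IsShortGrading 𝒢)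
    (t : IsGradedTriple 𝒢 (e : g) f h) : IsSimpleJordan (JordanPart 𝒢 e) := by
  have hne : 𝒢 (-1) ≠ ⊥ := (hs (-1)).2 (by simp)
  obtain ⟨y₀, hy₀, hy₀'⟩ := Submodule.exists_mem_ne_zero_of_ne_bot hne
  -- `f / 2` is a unit of the Jordan algebra.
  obtain ⟨F, hFf⟩ := JordanPart.exists_val_eq (e := e) t.f_mem
  obtain ⟨Y, rfl⟩ := JordanPart.exists_val_eq (e := e) hy₀
  have hY : Y ≠ 0 := fun h0 => hy₀' (by rw [h0, map_zero])
  have hF (x : JordanPart 𝒢 e) : F * x = (2 : K) • x := by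
    apply JordanPart.val_injective
    rw [JordanPart.val_mul, map_smul, hFf]
    exact t.lie_f_lie hs (JordanPart.val_mem x)
  refine ⟨JordanPart.mul_comm_of_isShortGrading hs, JordanPart.jordan_identity hs, ⟨?_⟩,
    F, Y, ?_⟩
  · have hnt : Nontrivial (JordanPart 𝒢 e) :=
      ⟨Y, 0, hY⟩
    refine { toNontrivial := inferInstance, eq_bot_or_eq_top := fun I => ?_ }
    have hsmul (c : K) (x : JordanPart 𝒢 e) (hx : x ∈ I) : c • x ∈ I := by
      have h1 : ((c / 2) • F) * x = c • x := by
        apply JordanPart.val_injective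
        rw [JordanPart.val_mul, map_smul, smul_lie, ← JordanPart.val_mul, hF, map_smul, map_smul,
          smul_smul, div_mul_cancel₀ _ two_ne_zero]
      rw [← h1]
      exact I.mul_mem_left _ _ hx
    let N : Submodule K g :=
      { carrier := {x | ∃ a ∈ I, JordanPart.val a = x}
        add_mem' := by
          rintro _ _ ⟨a, ha, rfl⟩ ⟨b, hb, rfl⟩
          exact ⟨a + b, I.add_mem ha hb, map_add _ _ _⟩
        zero_mem' := ⟨0, I.zero_mem, map_zero _⟩
        smul_mem' := by
          rintro c _ ⟨a, ha, rfl⟩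
          exact ⟨c • a, hsmul c a ha, map_smul _ _ _⟩ }
    have hN : N ≤ 𝒢 (-1) := by
      rintro _ ⟨a, -, rfl⟩
      exact JordanPart.val_mem a
    have hm {y n : g} (hy : y ∈ 𝒢 (-1)) (hn : n ∈ N) : ⁅⁅(e : g), y⁆, n⁆ ∈ N := by
      obtain ⟨a, ha, rfl⟩ := hn
      obtain ⟨b, rfl⟩ := JordanPart.exists_val_eq (e := e) hy
      refine ⟨-(b * a), I.neg_mem (I.mul_mem_left _ _ ha), ?_⟩
      rw [map_neg, JordanPart.val_mul' hs, neg_neg]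
    have hstab : ∀ z ∈ 𝒢 0, ∀ n ∈ N, ⁅z, n⁆ ∈ N := by
      intro z hz n hn
      have hz' := hs.zero_le_span hz
      clear hz
      induction hz' using Submodule.span_induction with
      | mem z hz =>
        obtain ⟨w, hw, y, hy, rfl⟩ := hz
        obtain ⟨x, hx, rfl⟩ := t.exists_lie_lie_eq hs hw
        have h1 := hs.lie_lie_lie_sub (K := K) (e : g) hx hy
        have h2 := hs.lie_lie_lie_add (K := K) (e : g) hx hy
        have h3 : ⁅⁅(e : g), ⁅(e : g), x⁆⁆, y⁆ =
            -⁅(e : g), ⁅x, ⁅(e : g), y⁆⁆⁆ - ⁅⁅(e : g), x⁆, ⁅(e : g), y⁆⁆ := by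
          linear_combination (norm := module) (1 / 2 : K) • h1 + (1 / 2 : K) • h2
        rw [h3, sub_lie, neg_lie, lie_lie ⁅(e : g), x⁆]
        exact sub_mem (neg_mem (hm (lie_mem_grading hx (t.lie_mem hy) rfl) hn))
          (sub_mem (hm hx (hm hy hn)) (hm hy (hm hx hn)))
      | zero => simp
      | add s t _ _ h1 h2 => rw [add_lie]; exact add_mem h1 h2
      | smul c s _ h => rw [smul_lie]; exact Submodule.smul_mem _ c h
    have hmem {x : JordanPart 𝒢 e} (hx : JordanPart.val x ∈ N) : x ∈ I := by
      obtain ⟨a, ha, hax⟩ := hx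
      rwa [← JordanPart.val_injective hax]
    rcases hs.eq_bot_or_le hN hstab with h0 | h0
    · left
      rw [eq_bot_iff]
      intro x hx
      have h1 : JordanPart.val x ∈ N := ⟨x, hx, rfl⟩
      rw [h0, Submodule.mem_bot] at h1
      rw [JordanPart.val_injective (h1.trans (map_zero _).symm)]
      exact TwoSidedIdeal.zero_mem _
    · right
      rw [eq_top_iff]
      intro x _
      exact hmem (h0 (JordanPart.val_mem x))
  · intro h0
    rw [hF] at h0
    exact hY ((smul_eq_zero.1 h0).resolve_left two_ne_zero)

end Jordan

end JordanCommuting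

open JordanCommuting in
theorem mainTheorem5 {K : Type*} [Field K] [IsAlgClosed K] [CharZero K]
    {g : Type*} [LieRing g] [LieAlgebra K g] [FiniteDimensional K g] [LieAlgebra.IsSimple K g]
    (𝒢 : ℤ → Submodule K g) [GradedLieAlgebra 𝒢] (hshort : IsShortGrading 𝒢)
    (e : 𝒢 1) (he : InDenseOrbit 𝒢 e)
    (hred : LieAlgebra.HasCentralRadical K (zeroCentralizer 𝒢 e)) :
    Nonempty (JordanTriad 𝒢 e) ∧ IsSimpleJordan (JordanPart 𝒢 e) ∧
    ∀ T : JordanTriad 𝒢 e,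
      quaternionicPart T.σ₁ T.σ₂ 0 1 = mSubspace 𝒢 e ∧
      quaternionicPart T.σ₁ T.σ₂ 1 0 =
        (mSubspace 𝒢 e).map (LieAlgebra.ad K g ((e : g) - T.f) : g →ₗ[K] g) ∧
      quaternionicPart T.σ₁ T.σ₂ 1 1 =
        (mSubspace 𝒢 e).map (LieAlgebra.ad K g ((e : g) + T.f) : g →ₗ[K] g) ∧
      AreIsomorphicVarieties K (commutingVariety (JordanPart 𝒢 e))
        {p | commutatorMap T.σ₁ T.σ₂ p = 0} := by
  obtain ⟨f, h, t⟩ := exists_isGradedTriple hshort he hred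
  refine ⟨t.nonempty_jordanTriad hshort, t.isSimpleJordan hshort, fun T =>
    ⟨T.quaternionicPart_zero_one hshort, ?_, ?_, T.areIsomorphicVarieties hshort⟩⟩
  · rw [T.quaternionicPart_one hshort (pow_zero _), one_smul]
  · rw [T.quaternionicPart_one hshort (pow_one _), neg_one_smul, sub_neg_eq_add]
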